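/- **Setting.** A partial function is a map $f:\{0,1\}^N\to\{0,1,*\}$, with $\mathrm{Dom}(f)=f^{-1}(\{0,1\})$. A randomised decision tree $R$ is a probability distribution over deterministic decision trees that never query the same bit twice. For $x\in\mathrm{Dom}(f)$ let $\mathrm{cost}(R,x)$ be the expected number of queries $R$ makes on $x$, and let $\mathrm{bias}(R,x)=\max\{1-2\Pr[R(x)\ne f(x)],0\}$. Put $$\mathrm{LR}(f)=\min_R\max_{x}\frac{\mathrm{cost}(R,x)}{\mathrm{bias}(R,x)},\qquad \mathrm{ULR}(f)=\min_R\max_{x,y}\frac{\mathrm{cost}(R,x)}{\mathrm{bias}(R,y)},$$ where $x,y$ range over $\mathrm{Dom}(f)$ and a ratio with denominator $0$ (in particular $0/0$) is $\infty$. **The function.** For $n=m^4$ let $B=8n^{9/2}$, $b_X=n^{-1}$ and $b_Y=n^{-3/4}$. View an input of $Bn=8n^{11/2}$ bits as $B$ blocks of $n$ bits. A block $(x_1,\dots,x_n)$ is easy if $x_1=0$, and then its value is $x_2$; it is hard if $x_1=1$, and then its value is $x_2\oplus\dots\oplus x_n$. Let $f_m(x)=v\in\{0,1\}$ if either $x$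 has no hard block and at least $B/2+Bb_X$ blocks of value $v$, or $x$ has exactly $4Bb_Y$ hard blocks and at least $B/2+Bb_Y$ blocks of value $v$; otherwise $f_m(x)=*$. **Theorem.** There are constants $c,C,\delta>0$ such that the following hold. 1. For all sufficiently large $m$, with $n=m^4$, $$\mathrm{LR}(f_m)\le C\,n,\qquad \mathrm{ULR}(f_m)\ge c\,n^{5/4},\qquad \mathrm{ULR}(f_m)\ge c\,\mathrm{LR}(f_m)^{5/4}\ge (Bn)^{\delta}.$$ 2. For all sufficiently large $N$ there is a partial function $f:\{0,1\}^N\to\{0,1,*\}$ with $$\mathrm{ULR}(f)\ge c\,\mathrm{LR}(f)^{5/4}\ge N^{\delta}.$$ -/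

import Mathlib

open scoped ENNReal NNReal

/-- Partial boolean functions on bits indexed by `ι`; the value `none` plays the role of `*`. -/
abbrev PartialBoolFun (ι : Type) : Type := (ι → Bool) → Option Bool

/-- The set of inputs on which a partial function is defined. -/
def PartialBoolFun.Dom {ι : Type} (f : PartialBoolFun ι) : Set (ι → Bool) :=
  {x | f x ≠ none}

/-- Deterministic decision trees: a leaf is labelled by an output; an internal node queries the
bit `i` and continues in `t₀` or `t₁` according to whether the answer is `0` or `1`. -/
inductive DecTree (ι : Type) : Type where
  | leaf (b : Bool) : DecTree ι
  | query (i : ι) (t₀ t₁ : DecTree ι) : DecTree ι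

/-- The output of a deterministic decision tree. -/
def DecTree.eval {ι : Type} : DecTree ι → (ι → Bool) → Bool
  | .leaf b, _ => b
  | .query i t₀ t₁, x => if x i then t₁.eval x else t₀.eval x

/-- The number of queries that a deterministic decision tree makes on `x`. -/
def DecTree.cost {ι : Type} : DecTree ι → (ι → Bool) → ℕ
  | .leaf _, _ => 0
  | .query i t₀ t₁, x => (if x i then t₁.cost x else t₀.cost x) + 1

/-- `t.Queries i` holds if some internal node of `t` is labelled by `i`. -/
def DecTree.Queries {ι : Type} : DecTree ι → ι → Prop
  | .leaf _, _ => False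
  | .query j t₀ t₁, i => j = i ∨ t₀.Queries i ∨ t₁.Queries i

/-- No internal node shares its label with an ancestor. -/
def DecTree.ReadOnce {ι : Type} : DecTree ι → Prop
  | .leaf _ => True
  | .query i t₀ t₁ => ¬ t₀.Queries i ∧ ¬ t₁.Queries i ∧ t₀.ReadOnce ∧ t₁.ReadOnce

/-- A randomised decision tree is a probability distribution over deterministic decision trees
that never query the same bit twice. -/
abbrev RandTree (ι : Type) : Type := PMF {D : DecTree ι // D.ReadOnce}

noncomputable section

/-- The expected number of queries that `R` makes on `x`. -/
def RandTree.cost {ι : Type} (R : RandTree ι) (x : ι → Bool) : ℝ≥0∞ :=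
  ∑' D : {D : DecTree ι // D.ReadOnce}, R D * (D.1.cost x : ℝ≥0∞)

open Classical in
/-- The probability that `R` does not output `f x` on input `x`. -/
def RandTree.err {ι : Type} (f : PartialBoolFun ι) (R : RandTree ι) (x : ι → Bool) : ℝ≥0∞ :=
  ∑' D : {D : DecTree ι // D.ReadOnce}, if some (D.1.eval x) = f x then 0 else R D

/-- The bias `max {1 - 2 err, 0}`: subtraction in `ℝ≥0∞` is truncated at `0`. -/
def RandTree.bias {ι : Type} (f : PartialBoolFun ι) (R : RandTree ι) (x : ι → Bool) : ℝ≥0∞ :=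
  1 - 2 * R.err f x

/-- The ratio of a cost `a` and a bias `b`, equal to `∞` whenever `b = 0` (also for `0 / 0`). -/
def costBiasRatio (a b : ℝ≥0∞) : ℝ≥0∞ := if b = 0 then ∞ else a / b

/-- Linearised randomised query complexity: `min_R max_x cost(R,x) / bias(R,x)`, where `x` ranges
over the domain of `f`. -/
def LR {ι : Type} (f : PartialBoolFun ι) : ℝ≥0∞ :=
  ⨅ R : RandTree ι, ⨆ x ∈ f.Dom, costBiasRatio (R.cost x) (R.bias f x)

/-- Uniform linearised randomised query complexity: `min_R max_{x,y} cost(R,x) / bias(R,y)`, where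
`x` and `y` range independently over the domain of `f`. -/
def ULR {ι : Type} (f : PartialBoolFun ι) : ℝ≥0∞ :=
  ⨅ R : RandTree ι, ⨆ x ∈ f.Dom, ⨆ y ∈ f.Dom, costBiasRatio (R.cost x) (R.bias f y)

/-- The bit of a block at the position `j`, counted from `0` (`false` past the end). -/
def blockBit {n : ℕ} (y : Fin n → Bool) (j : ℕ) : Bool :=
  if h : j < n then y ⟨j, h⟩ else false

/-- A block is hard if its first bit is `1`, and easy otherwise. -/
def blockHard {n : ℕ} (y : Fin n → Bool) : Bool := blockBit y 0

/-- The value of a block: the parity of all bits but the first if the block is hard, and the second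
bit if it is easy. -/
def blockValue {n : ℕ} (y : Fin n → Bool) : Bool :=
  if blockHard y then
    decide (Odd (Finset.univ.filter fun i : Fin n => 0 < i.val ∧ y i = true).card)
  else blockBit y 1

/-- The number of hard blocks of an input made of `B` blocks of `n` bits. -/
def numHard {n B : ℕ} (x : Fin B × Fin n → Bool) : ℕ :=
  (Finset.univ.filter fun i : Fin B => blockHard (fun j => x (i, j)) = true).card

/-- The number of blocks of value `v`. -/
def numValue {n B : ℕ} (x : Fin B × Fin n → Bool) (v : Bool) : ℕ :=
  (Finset.univ.filter fun i : Fin B => blockValue (fun j => x (i, j)) = v).card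

/-- The promise on inputs of value `v`: either there are no hard blocks and at least
`B/2 + B bX` blocks have the value `v`, or there are exactly `4 B bY` hard blocks and at least
`B/2 + B bY` blocks have the value `v`. -/
def SepPromise {n B : ℕ} (bX bY : ℝ) (x : Fin B × Fin n → Bool) (v : Bool) : Prop :=
  (numHard x = 0 ∧ (B : ℝ) / 2 + B * bX ≤ numValue x v) ∨
  ((numHard x : ℝ) = 4 * B * bY ∧ (B : ℝ) / 2 + B * bY ≤ numValue x v)

open Classical in
/-- The majority value of the blocks, under the promise above. For `bX, bY > 0` the promise
holds for at most one `v`, which is then the strict majority value. -/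
def sepFun (n B : ℕ) (bX bY : ℝ) : PartialBoolFun (Fin B × Fin n) := fun x =>
  if SepPromise bX bY x true then some true
  else if SepPromise bX bY x false then some false
  else none

/-- The separating function with `n = m ^ 4`, `B = 8 n^(9/2) = 8 m ^ 18`, `bX = 1 / n` and
`bY = n^(-3/4) = 1 / m ^ 3`; its inputs have `B n = 8 m ^ 22` bits. -/
def sepFamily (m : ℕ) : PartialBoolFun (Fin (8 * m ^ 18) × Fin (m ^ 4)) :=
  sepFun (m ^ 4) (8 * m ^ 18) (1 / (m : ℝ) ^ 4) (1 / (m : ℝ) ^ 3)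

end

/-! Upper bound for `LR` (`LR_le`): evaluate a uniformly random block. Without hard blocks this
costs 2 queries and has bias at least `2 / m ^ 4`. With hard blocks the expected cost rises to at
most `2 + 4 * m`, but the bias rises to at least `2 / m ^ 3`. Both ratios are `O(m ^ 4) = O(n)`. For
`ULR` the larger cost meets the smaller bias, and the lower bound shows that the resulting order `m
^ 5 = n ^ (5 / 4)` cannot be improved.

The lower bound uses four input distributions: without or with hard blocks, of value 0 or 1. In the
inputs with hard blocks, all hard blocks have the value `v`, whereas the easy blocks lean against
`v`, by a margin exactly `m` times the margin towards `v` in the inputs without hard blocks. The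
core is `combined_advantage_le`: for every deterministic tree, `m` times its advantage without hard
blocks plus its advantage with hard blocks is at most `3000 / m ^ 4` times the sum of its four
expected costs. If every bias is at least `β` and every cost at most `ρ * β`, this gives `m * β =
O(ρ * β / m ^ 4)`, so `ρ` is at least of order `m ^ 5` (`le_ULR`).

The core has two steps. The parity of a hard block stays hidden until a secret random position among
`n - 1` is queried; this changes the advantage with hard blocks by at most cost over `n - 1`
(`abs_hardAvg_sub_procAvg_le`). What remains is a procedure that sees only symbols (hard, easy 0,
easy 1) drawn without replacement (`BlockProc.abs_combined_le`). During its first `m ^ 2` draws, and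
until a hard block appears, the four likelihoods agree up to a factor `1 + O(1 / m)` and the
first-order gains from easy blocks cancel, leaving `O(1 / m ^ 4)` per draw. Afterwards the two kinds
of inputs are treated separately by Hellinger distance, with a start-up loss that `m ^ 2` draws, or
the rarity of hard blocks, can pay for. -/

set_option linter.unusedSectionVars false

/-! ### Lower bounds for `ULR` and `LR` from hard input distributions -/

open Classical in
/-- The error indicator of a deterministic tree. -/
noncomputable def DecTree.err {ι : Type} (f : PartialBoolFun ι) (D : DecTree ι)
    (x : ι → Bool) : ℝ≥0 :=
  if some (D.eval x) = f x then 0 else 1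

lemma RandTree.err_eq {ι : Type} (f : PartialBoolFun ι) (R : RandTree ι) (x : ι → Bool) :
    R.err f x = ∑' D, R D * (D.1.err f x : ℝ≥0∞) := by
  unfold RandTree.err DecTree.err
  refine tsum_congr fun D => ?_
  split_ifs <;> simp

/-- An inequality between weighted costs and errors valid for all deterministic trees also holds
for randomised trees. -/
lemma RandTree.sum_weight_le {ι Ω : Type} {f : PartialBoolFun ι} (S : Finset Ω)
    (x : Ω → ι → Bool) (ω κ : Ω → ℝ≥0)
    (h : ∀ D : DecTree ι, ∑ a ∈ S, ω a ≤
      ∑ a ∈ S, κ a * (D.cost (x a) : ℝ≥0) + 2 * ∑ a ∈ S, ω a * D.err f (x a))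
    (R : RandTree ι) :
    ∑ a ∈ S, (ω a : ℝ≥0∞) ≤
      ∑ a ∈ S, (κ a : ℝ≥0∞) * R.cost (x a) + ∑ a ∈ S, (ω a : ℝ≥0∞) * (2 * R.err f (x a)) := by
  have h' : ∀ D : {D : DecTree ι // D.ReadOnce}, R D * ∑ a ∈ S, (ω a : ℝ≥0∞) ≤
      ∑ a ∈ S, (κ a : ℝ≥0∞) * (R D * (D.1.cost (x a) : ℝ≥0∞)) +
        ∑ a ∈ S, (ω a : ℝ≥0∞) * (2 * (R D * (D.1.err f (x a) : ℝ≥0∞))) := by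
    intro D
    have := ENNReal.coe_le_coe.2 (h D.1)
    push_cast at this
    refine (mul_le_mul_right this (R D)).trans (le_of_eq ?_)
    rw [mul_add, Finset.mul_sum, Finset.mul_sum, Finset.mul_sum]
    congr 1
    · exact Finset.sum_congr rfl fun a _ => by ring
    · exact Finset.sum_congr rfl fun a _ => by ring
  calc ∑ a ∈ S, (ω a : ℝ≥0∞) = ∑' D, R D * ∑ a ∈ S, (ω a : ℝ≥0∞) := by
        rw [ENNReal.tsum_mul_right, PMF.tsum_coe, one_mul]
    _ ≤ _ := ENNReal.tsum_le_tsum h'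
    _ = _ := by
        rw [ENNReal.tsum_add, Summable.tsum_finsetSum (fun _ _ => ENNReal.summable),
          Summable.tsum_finsetSum (fun _ _ => ENNReal.summable)]
        simp only [ENNReal.tsum_mul_left, RandTree.err_eq, RandTree.cost]

lemma cost_le_of_costBiasRatio_le {a b r : ℝ≥0∞} (h : costBiasRatio a b ≤ r) (hr : r ≠ ∞)
    (hb' : b ≠ ∞) : b ≠ 0 ∧ a ≤ r * b := by
  unfold costBiasRatio at h
  split_ifs at h with hb
  · exact absurd (top_le_iff.1 h) hr
  · exact ⟨hb, (ENNReal.div_le_iff hb hb').1 h⟩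

lemma RandTree.bias_le_one {ι : Type} (f : PartialBoolFun ι) (R : RandTree ι) (x : ι → Bool) :
    R.bias f x ≤ 1 := tsub_le_self

lemma RandTree.bias_ne_top {ι : Type} (f : PartialBoolFun ι) (R : RandTree ι) (x : ι → Bool) :
    R.bias f x ≠ ∞ := ne_top_of_le_ne_top ENNReal.one_ne_top (R.bias_le_one f x)

/-- A nonzero bias means that the subtraction was not truncated, so bias and error determine each
other. -/
lemma RandTree.bias_add_err {ι : Type} {f : PartialBoolFun ι} {R : RandTree ι} {x : ι → Bool}
    (h : R.bias f x ≠ 0) : R.bias f x + 2 * R.err f x = 1 := by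
  refine tsub_add_cancel_of_le ?_
  by_contra hlt
  exact h (tsub_eq_zero_of_le (not_le.1 hlt).le)

/-- Lower bound for `ULR` from a hard input distribution. -/
lemma le_ULR {ι Ω : Type} {f : PartialBoolFun ι} (S : Finset Ω)
    (x : Ω → ι → Bool) (hx : ∀ a ∈ S, x a ∈ f.Dom) (ω κ : Ω → ℝ≥0) (hκ : 0 < ∑ a ∈ S, κ a)
    (h : ∀ D : DecTree ι, ∑ a ∈ S, ω a ≤
      ∑ a ∈ S, κ a * (D.cost (x a) : ℝ≥0) + 2 * ∑ a ∈ S, ω a * D.err f (x a)) :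
    ((∑ a ∈ S, ω a : ℝ≥0) : ℝ≥0∞) ≤ (∑ a ∈ S, κ a : ℝ≥0) * ULR f := by
  have hS : S.Nonempty := by
    by_contra hS
    rw [Finset.not_nonempty_iff_eq_empty] at hS
    simp [hS] at hκ
  have hκ' : ((∑ a ∈ S, κ a : ℝ≥0) : ℝ≥0∞) ≠ 0 := by exact_mod_cast hκ.ne'
  unfold ULR
  rw [ENNReal.mul_iInf_of_ne hκ' ENNReal.coe_ne_top]
  refine le_iInf fun R => ?_
  set ρ := ⨆ x ∈ f.Dom, ⨆ y ∈ f.Dom, costBiasRatio (R.cost x) (R.bias f y) with hρ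
  by_cases hρt : ρ = ∞
  · rw [hρt, ENNReal.mul_top hκ']; exact le_top
  have key : ∀ a ∈ S, ∀ b ∈ S, R.bias f (x b) ≠ 0 ∧ R.cost (x a) ≤ ρ * R.bias f (x b) := by
    intro a ha b hb
    refine cost_le_of_costBiasRatio_le ?_ hρt (R.bias_ne_top f _)
    rw [hρ]
    exact le_iSup₂_of_le (x a) (hx a ha)
      (le_iSup₂ (f := fun y _ => costBiasRatio (R.cost (x a)) (R.bias f y)) (x b) (hx b hb))
  -- The uniform measure bounds every cost by `ρ` times the smallest bias `β`, and every doubled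
  -- error is at most `1 - β`. Both sides then carry the factor `β`, which cancels.
  obtain ⟨b, hb, hmin⟩ := S.exists_min_image (fun a => R.bias f (x a)) hS
  set β := R.bias f (x b)
  have hβ0 : β ≠ 0 := (key b hb b hb).1
  have hβt : β ≠ ∞ := R.bias_ne_top f _
  have hβ1 : β ≤ 1 := R.bias_le_one f _
  have hmain := RandTree.sum_weight_le S x ω κ h R
  push_cast
  set W := ∑ a ∈ S, (ω a : ℝ≥0∞) with hW
  have hWt : W ≠ ∞ := by
    rw [hW, ENNReal.sum_ne_top]; exact fun a _ => ENNReal.coe_ne_top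
  have h1 : ∑ a ∈ S, (κ a : ℝ≥0∞) * R.cost (x a) ≤ (∑ a ∈ S, (κ a : ℝ≥0∞)) * (ρ * β) := by
    rw [Finset.sum_mul]
    exact Finset.sum_le_sum fun a ha => mul_le_mul_right (key a ha b hb).2 _
  have h2 : ∑ a ∈ S, (ω a : ℝ≥0∞) * (2 * R.err f (x a)) ≤ W * (1 - β) := by
    rw [Finset.sum_mul]
    refine Finset.sum_le_sum fun a ha => mul_le_mul_right ?_ _
    refine ENNReal.le_sub_of_add_le_left hβt ?_
    rw [← RandTree.bias_add_err (key a ha a ha).1]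
    gcongr
    exact hmin a ha
  have h3 : W * β + W * (1 - β) = W := by
    rw [← mul_add, add_tsub_cancel_of_le hβ1, mul_one]
  have h4 : W * β + W * (1 - β) ≤ (∑ a ∈ S, (κ a : ℝ≥0∞)) * (ρ * β) + W * (1 - β) := by
    rw [h3]; exact hmain.trans (add_le_add h1 h2)
  have h5 : W * (1 - β) ≠ ∞ :=
    ENNReal.mul_ne_top hWt (ne_top_of_le_ne_top ENNReal.one_ne_top tsub_le_self)
  have h6 := (ENNReal.add_le_add_iff_right h5).1 h4
  rw [← mul_assoc] at h6
  exact (ENNReal.mul_le_mul_iff_left hβ0 hβt).1 h6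

/-- Lower bound for `LR` from a hard input distribution. -/
lemma le_LR {ι Ω : Type} {f : PartialBoolFun ι} (S : Finset Ω)
    (x : Ω → ι → Bool) (hx : ∀ a ∈ S, x a ∈ f.Dom) (ω : Ω → ℝ≥0) (K : ℝ≥0) (hK : 0 < K)
    (hω : 0 < ∑ a ∈ S, ω a)
    (h : ∀ D : DecTree ι, ∑ a ∈ S, ω a ≤
      ∑ a ∈ S, (K * ω a) * (D.cost (x a) : ℝ≥0) + 2 * ∑ a ∈ S, ω a * D.err f (x a)) :
    1 ≤ K * LR f := by
  have hK' : (K : ℝ≥0∞) ≠ 0 := by exact_mod_cast hK.ne'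
  unfold LR
  rw [ENNReal.mul_iInf_of_ne hK' ENNReal.coe_ne_top]
  refine le_iInf fun R => ?_
  set ρ := ⨆ x ∈ f.Dom, costBiasRatio (R.cost x) (R.bias f x) with hρ
  by_cases hρt : ρ = ∞
  · rw [hρt, ENNReal.mul_top hK']; exact le_top
  have key : ∀ a ∈ S, R.bias f (x a) ≠ 0 ∧ R.cost (x a) ≤ ρ * R.bias f (x a) := by
    intro a ha
    refine cost_le_of_costBiasRatio_le ?_ hρt (R.bias_ne_top f _)
    rw [hρ]
    exact le_iSup₂ (f := fun y _ => costBiasRatio (R.cost y) (R.bias f y)) (x a) (hx a ha)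
  have hmain := RandTree.sum_weight_le S x ω _ h R
  set E := ∑ a ∈ S, (ω a : ℝ≥0∞) * (2 * R.err f (x a)) with hE
  set b := ∑ a ∈ S, (ω a : ℝ≥0∞) * R.bias f (x a) with hb
  have h1 : b + E = ∑ a ∈ S, (ω a : ℝ≥0∞) := by
    rw [hb, hE, ← Finset.sum_add_distrib]
    refine Finset.sum_congr rfl fun a ha => ?_
    rw [← mul_add, RandTree.bias_add_err (key a ha).1, mul_one]
  have hWt : b + E ≠ ∞ := by
    rw [h1, ENNReal.sum_ne_top]; exact fun a _ => ENNReal.coe_ne_top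
  have hEt : E ≠ ∞ := ne_top_of_le_ne_top hWt le_add_self
  have hbt : b ≠ ∞ := ne_top_of_le_ne_top hWt le_self_add
  have hb0 : b ≠ 0 := by
    intro h0
    rw [hb, Finset.sum_eq_zero_iff] at h0
    refine hω.ne' (Finset.sum_eq_zero fun a ha => ?_)
    simpa [(key a ha).1] using h0 a ha
  -- A cost is now controlled only by the bias at the same input, which is why the cost weights have
  -- to be proportional to `ω`.
  have h2 : ∑ a ∈ S, ((K * ω a : ℝ≥0) : ℝ≥0∞) * R.cost (x a) ≤ K * ρ * b := by
    rw [hb, Finset.mul_sum]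
    refine Finset.sum_le_sum fun a ha => ?_
    refine (mul_le_mul_right (key a ha).2 _).trans (le_of_eq ?_)
    push_cast; ring
  rw [← h1] at hmain
  have h3 : b ≤ K * ρ * b := (ENNReal.add_le_add_iff_right hEt).1 (hmain.trans (by gcongr))
  have h4 : 1 * b ≤ K * ρ * b := by rwa [one_mul]
  exact (ENNReal.mul_le_mul_iff_left hb0 hbt).1 h4

/-! ### Copies of a function on additional, ignored bits -/

/-- Extension of an input along an embedding by `false`. -/
noncomputable def extendInput {κ ι : Type} (e : κ ↪ ι) (x : κ → Bool) : ι → Bool :=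
  Function.extend e x fun _ => false

lemma extendInput_comp {κ ι : Type} (e : κ ↪ ι) (x : κ → Bool) : extendInput e x ∘ e = x :=
  Function.extend_comp e.injective _ _

open Classical in
/-- Restriction of a tree along an embedding: the bits outside of the range read `false`. -/
noncomputable def DecTree.restrict {κ ι : Type} (e : κ ↪ ι) : DecTree ι → DecTree κ
  | .leaf b => .leaf b
  | .query i t₀ t₁ =>
    if h : ∃ a, e a = i then .query h.choose (t₀.restrict e) (t₁.restrict e) else t₀.restrict e

lemma DecTree.eval_restrict {κ ι : Type} (e : κ ↪ ι) (x : κ → Bool) (D : DecTree ι) :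
    (D.restrict e).eval x = D.eval (extendInput e x) := by
  induction D with
  | leaf b => rfl
  | query i t₀ t₁ h₀ h₁ =>
    unfold DecTree.restrict
    split_ifs with h
    · have : extendInput e x i = x h.choose := by
        conv_lhs => rw [← h.choose_spec]
        exact e.injective.extend_apply _ _ _
      simp only [DecTree.eval, h₀, h₁, this]
    · have : extendInput e x i = false := Function.extend_apply' _ _ _ h
      simp [DecTree.eval, h₀, this]

/-- Nodes outside the range of `e` disappear, hence only an inequality. -/
lemma DecTree.cost_restrict_le {κ ι : Type} (e : κ ↪ ι) (x : κ → Bool) (D : DecTree ι) :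
    (D.restrict e).cost x ≤ D.cost (extendInput e x) := by
  induction D with
  | leaf b => simp [DecTree.restrict, DecTree.cost]
  | query i t₀ t₁ h₀ h₁ =>
    unfold DecTree.restrict
    split_ifs with h
    · have : extendInput e x i = x h.choose := by
        conv_lhs => rw [← h.choose_spec]
        exact e.injective.extend_apply _ _ _
      simp only [DecTree.cost, this]
      split_ifs <;> omega
    · have : extendInput e x i = false := Function.extend_apply' _ _ _ h
      simp only [DecTree.cost, this, Bool.false_eq_true, if_false]
      omega

/-! ### Procedures that reveal the symbols of blocks -/

/-- Adaptive procedures that reveal the symbols of blocks (`none` for hard, `some s` for easy of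
value `s`) and stop with a real output. -/
inductive BlockProc (β : Type) : Type where
  | leaf (g : ℝ) : BlockProc β
  | node (i : β) (f : Option Bool → BlockProc β) : BlockProc β

namespace BlockProc

variable {β : Type}

/-- The output on an assignment of symbols. -/
def out : BlockProc β → (β → Option Bool) → ℝ
  | .leaf g, _ => g
  | .node i f, z => (f (z i)).out z

/-- The number of revealed blocks. -/
def touches : BlockProc β → (β → Option Bool) → ℝ
  | .leaf _, _ => 0
  | .node i f, z => (f (z i)).touches z + 1

/-- The procedure reveals only blocks unknown in `k`, no block twice, and has outputs in
`[-1, 1]`. -/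
def Fresh [DecidableEq β] : BlockProc β → (β → Option (Option Bool)) → Prop
  | .leaf g, _ => |g| ≤ 1
  | .node i f, k => k i = none ∧ ∀ s, (f s).Fresh (Function.update k i (some s))

lemma abs_out_le [DecidableEq β] (A : BlockProc β) (k : β → Option (Option Bool))
    (h : A.Fresh k) (z : β → Option Bool) : |A.out z| ≤ 1 := by
  induction A generalizing k with
  | leaf g => exact h
  | node i f ih => exact ih _ _ (h.2 _)

lemma touches_nonneg (A : BlockProc β) (z : β → Option Bool) : 0 ≤ A.touches z := by
  induction A with
  | leaf g => exact le_rfl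
  | node i f ih => have := ih (z i); simp only [touches]; linarith

end BlockProc

/-! ### Sampling symbols without replacement -/

section Urn

variable {β : Type} [Fintype β] [DecidableEq β]

/-- The assignment `z` extends the partial assignment `k`. -/
def Extends (k : β → Option (Option Bool)) (z : β → Option Bool) : Prop :=
  ∀ i s, k i = some s → z i = s

open Classical in
/-- The assignments in which each symbol `s` occurs `c s` times. -/
noncomputable def urn (c : Option Bool → ℝ) : Finset (β → Option Bool) :=
  Finset.univ.filter fun z => ∀ s, ((Finset.univ.filter fun i => z i = s).card : ℝ) = c s

open Classical in
/-- The part of the average of `F` over the urn that comes from extensions of `k`. -/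
noncomputable def urnAvg (c : Option Bool → ℝ) (k : β → Option (Option Bool))
    (F : (β → Option Bool) → ℝ) : ℝ :=
  (∑ z ∈ (urn c).filter (Extends k), F z) / (urn (β := β) c).card

/-- The probability that a random element of the urn extends `k`. -/
noncomputable def urnWt (c : Option Bool → ℝ) (k : β → Option (Option Bool)) : ℝ :=
  urnAvg c k fun _ => 1

/-- The number of known blocks. -/
def known (k : β → Option (Option Bool)) : ℕ := (Finset.univ.filter fun i => k i ≠ none).card

/-- The number of blocks known to have symbol `s`. -/
def seen (k : β → Option (Option Bool)) (s : Option Bool) : ℕ :=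
  (Finset.univ.filter fun i => k i = some s).card

lemma extends_update {k : β → Option (Option Bool)} {i : β} (hi : k i = none) (s : Option Bool)
    (z : β → Option Bool) :
    Extends (Function.update k i (some s)) z ↔ Extends k z ∧ z i = s := by
  constructor
  · intro h
    refine ⟨fun j t hj => h j t ?_, h i s (by simp)⟩
    have : j ≠ i := by rintro rfl; simp [hi] at hj
    simpa [Function.update_of_ne this] using hj
  · rintro ⟨h, hz⟩ j t hj
    by_cases hji : j = i
    · subst hji; simp at hj; rw [hz, hj]
    · rw [Function.update_of_ne hji] at hj; exact h j t hj

lemma extends_none (z : β → Option Bool) : Extends (fun _ => none) z := by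
  intro i s h; simp at h

/-- `urnAvg` is normalised by the whole urn and not by the extensions of `k`. Thus it is additive
over the children of a node, and no conditioning on null events occurs. -/
lemma urnAvg_split (c : Option Bool → ℝ) {k : β → Option (Option Bool)} {i : β}
    (hi : k i = none) (F : (β → Option Bool) → ℝ) :
    urnAvg c k F = ∑ s, urnAvg c (Function.update k i (some s)) F := by
  classical
  unfold urnAvg
  rw [← Finset.sum_div]
  congr 1
  simp only [Finset.sum_filter, extends_update hi]
  rw [Finset.sum_comm]
  refine Finset.sum_congr rfl fun z _ => ?_
  by_cases h : Extends k z <;> simp [h]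

lemma urnAvg_congr (c : Option Bool → ℝ) {k : β → Option (Option Bool)}
    {F G : (β → Option Bool) → ℝ} (h : ∀ z, Extends k z → F z = G z) :
    urnAvg c k F = urnAvg c k G := by
  classical
  unfold urnAvg
  congr 1
  exact Finset.sum_congr rfl fun z hz => h z (Finset.mem_filter.1 hz).2

lemma urnAvg_add (c : Option Bool → ℝ) (k : β → Option (Option Bool))
    (F G : (β → Option Bool) → ℝ) :
    urnAvg c k (fun z => F z + G z) = urnAvg c k F + urnAvg c k G := by
  unfold urnAvg
  rw [Finset.sum_add_distrib, add_div]

lemma urnAvg_const (c : Option Bool → ℝ) (k : β → Option (Option Bool)) (g : ℝ) :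
    urnAvg c k (fun _ => g) = g * urnWt c k := by
  unfold urnWt urnAvg
  simp only [Finset.sum_const, nsmul_eq_mul]
  ring

lemma urnAvg_nonneg (c : Option Bool → ℝ) (k : β → Option (Option Bool))
    {F : (β → Option Bool) → ℝ} (hF : ∀ z, 0 ≤ F z) : 0 ≤ urnAvg c k F :=
  div_nonneg (Finset.sum_nonneg fun z _ => hF z) (Nat.cast_nonneg _)

lemma urnWt_nonneg (c : Option Bool → ℝ) (k : β → Option (Option Bool)) : 0 ≤ urnWt c k :=
  urnAvg_nonneg c k fun _ => zero_le_one

lemma abs_urnAvg_le (c : Option Bool → ℝ) (k : β → Option (Option Bool))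
    {F : (β → Option Bool) → ℝ} (hF : ∀ z, |F z| ≤ 1) : |urnAvg c k F| ≤ urnWt c k := by
  unfold urnWt urnAvg
  rw [abs_div, Nat.abs_cast]
  gcongr
  exact (Finset.abs_sum_le_sum_abs _ _).trans (Finset.sum_le_sum fun z _ => hF z)

lemma known_update {k : β → Option (Option Bool)} {i : β} (hi : k i = none) (s : Option Bool) :
    known (Function.update k i (some s)) = known k + 1 := by
  unfold known
  rw [← Finset.card_insert_of_notMem (a := i) (by simp [hi])]
  congr 1
  ext j
  by_cases h : j = i
  · subst h; simp
  · simp [h]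

lemma seen_update {k : β → Option (Option Bool)} {i : β} (hi : k i = none) (s t : Option Bool) :
    seen (Function.update k i (some s)) t = seen k t + if s = t then 1 else 0 := by
  unfold seen
  split_ifs with hst
  · subst hst
    rw [← Finset.card_insert_of_notMem (a := i) (by simp [hi])]
    congr 1
    ext j
    by_cases h : j = i
    · subst h; simp
    · simp [h]
  · rw [add_zero]
    congr 1
    ext j
    by_cases h : j = i
    · subst h; simp [hst, hi]
    · simp [Function.update_of_ne h]

lemma sum_seen (k : β → Option (Option Bool)) : ∑ s, seen k s = known k := by
  unfold seen known
  rw [← Finset.card_biUnion]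
  · congr 1
    ext i
    simp only [Finset.mem_biUnion, Finset.mem_univ, Finset.mem_filter, true_and]
    rw [← Option.isSome_iff_ne_none, Option.isSome_iff_exists]
  · intro s _ t _ hst
    rw [Function.onFun, Finset.disjoint_left]
    intro i hi hj
    simp only [Finset.mem_filter, Finset.mem_univ, true_and] at hi hj
    rw [hi] at hj
    exact hst (Option.some.inj hj)

lemma known_lt {k : β → Option (Option Bool)} {i : β} (hi : k i = none) :
    known k < Fintype.card β := by
  unfold known
  exact Finset.card_lt_univ_of_notMem (x := i) (by simp [hi])

lemma known_none : known (fun _ : β => none) = 0 := by simp [known]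

lemma seen_none (s : Option Bool) : seen (fun _ : β => none) s = 0 := by simp [seen]

lemma urnAvg_none (c : Option Bool → ℝ) (F : (β → Option Bool) → ℝ) :
    urnAvg c (fun _ => none) F = (∑ z ∈ urn c, F z) / (urn (β := β) c).card := by
  classical
  unfold urnAvg
  rw [Finset.filter_true_of_mem fun z _ => extends_none z]

lemma urnWt_none {c : Option Bool → ℝ} (h : (urn (β := β) c).Nonempty) :
    urnWt c (fun _ : β => none) = 1 := by
  unfold urnWt
  rw [urnAvg_none, Finset.sum_const, nsmul_eq_mul, mul_one, div_self]
  exact_mod_cast h.card_pos.ne'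

lemma card_filter_comp_swap (z : β → Option Bool) (i j : β) (s : Option Bool) :
    (Finset.univ.filter fun a => (z ∘ Equiv.swap i j) a = s).card =
      (Finset.univ.filter fun a => z a = s).card :=
  Finset.card_bij' (fun a _ => Equiv.swap i j a) (fun a _ => Equiv.swap i j a)
    (by simp) (by simp) (by simp) (by simp)

/-- All unknown blocks are equally likely to have symbol `s`. -/
lemma urnWt_update_eq (c : Option Bool → ℝ) {k : β → Option (Option Bool)} {i j : β}
    (hi : k i = none) (hj : k j = none) (s : Option Bool) :
    urnWt c (Function.update k i (some s)) = urnWt c (Function.update k j (some s)) := by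
  classical
  unfold urnWt urnAvg
  simp only [Finset.sum_const, nsmul_eq_mul, mul_one]
  congr 2
  -- Exchanging the blocks `i` and `j` keeps all symbol counts and moves no known block.
  have hk : ∀ z, Extends k z → Extends k (z ∘ Equiv.swap i j) := by
    intro z hz a t ha
    have h1 : a ≠ i := by rintro rfl; simp [hi] at ha
    have h2 : a ≠ j := by rintro rfl; simp [hj] at ha
    simp only [Function.comp_apply, Equiv.swap_apply_of_ne_of_ne h1 h2]
    exact hz a t ha
  have hu : ∀ z, z ∈ urn (β := β) c → z ∘ Equiv.swap i j ∈ urn (β := β) c := by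
    intro z hz
    simp only [urn, Finset.mem_filter, Finset.mem_univ, true_and] at hz ⊢
    intro t
    rw [card_filter_comp_swap]; exact hz t
  refine Finset.card_bij' (fun z _ => z ∘ Equiv.swap i j) (fun z _ => z ∘ Equiv.swap i j) ?_ ?_ ?_ ?_
  · intro z hz
    rw [Finset.mem_filter, extends_update hi] at hz
    rw [Finset.mem_filter, extends_update hj]
    exact ⟨hu z hz.1, hk z hz.2.1, by simpa using hz.2.2⟩
  · intro z hz
    rw [Finset.mem_filter, extends_update hj] at hz
    rw [Finset.mem_filter, extends_update hi]
    exact ⟨hu z hz.1, hk z hz.2.1, by simpa using hz.2.2⟩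
  · intro z _; ext1 a; simp
  · intro z _; ext1 a; simp

lemma card_unknown_eq {c : Option Bool → ℝ} {k : β → Option (Option Bool)} {z : β → Option Bool}
    (hz : z ∈ urn c) (hk : Extends k z) (s : Option Bool) :
    ((Finset.univ.filter fun j => k j = none ∧ z j = s).card : ℝ) = c s - seen k s := by
  classical
  simp only [urn, Finset.mem_filter, Finset.mem_univ, true_and] at hz
  rw [← hz s, eq_sub_iff_add_eq]
  norm_cast
  unfold seen
  rw [← Finset.card_union_of_disjoint]
  · congr 1
    ext j
    simp only [Finset.mem_union, Finset.mem_filter, Finset.mem_univ, true_and]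
    constructor
    · rintro (h | h)
      · exact h.2
      · exact hk j s h
    · intro h
      rcases hkj : k j with _ | t
      · exact Or.inl ⟨rfl, h⟩
      · right; rw [← hk j t hkj, h]
  · rw [Finset.disjoint_left]
    intro j h1 h2
    simp only [Finset.mem_filter, Finset.mem_univ, true_and] at h1 h2
    simp [h1.1] at h2

/-- The conditional probability of a symbol, given the known blocks. -/
lemma urnWt_update_mul (c : Option Bool → ℝ) {k : β → Option (Option Bool)} {i : β}
    (hi : k i = none) (s : Option Bool) :
    urnWt c (Function.update k i (some s)) * ((Fintype.card β : ℝ) - known k) =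
      (c s - seen k s) * urnWt c k := by
  classical
  have hcard : ((Fintype.card β : ℝ) - known k) =
      ((Finset.univ.filter fun j => k j = none).card : ℝ) := by
    rw [sub_eq_iff_eq_add]
    norm_cast
    unfold known
    exact (Finset.card_filter_add_card_filter_not _).symm
  -- Double counting of pairs of an extension and an unknown block with symbol `s` in it. By
  -- symmetry all unknown blocks contribute equally.
  have h1 : ∑ j ∈ Finset.univ.filter (fun j => k j = none),
      urnWt c (Function.update k j (some s)) = (c s - seen k s) * urnWt c k := by
    unfold urnWt urnAvg
    rw [← Finset.sum_div, mul_div_assoc']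
    congr 1
    simp only [Finset.sum_const, nsmul_eq_mul, mul_one, Finset.card_filter, Nat.cast_sum]
    rw [Finset.sum_comm, Finset.mul_sum]
    refine Finset.sum_congr rfl fun z hz => ?_
    by_cases h : Extends k z
    · rw [← card_unknown_eq hz h, Finset.card_filter]
      simp only [h, if_true, Nat.cast_one, mul_one, Nat.cast_sum, Finset.sum_filter,
        ite_and]
      refine Finset.sum_congr rfl fun j _ => ?_
      split_ifs with h1 h2 h3 h3
      all_goals simp_all [extends_update]
    · simp only [h, if_false, Nat.cast_zero, mul_zero]
      refine Finset.sum_eq_zero fun j hj => ?_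
      rw [extends_update (Finset.mem_filter.1 hj).2]
      simp [h]
  rw [← h1, hcard, Finset.sum_congr rfl fun j hj =>
    (urnWt_update_eq c (Finset.mem_filter.1 hj).2 hi s), Finset.sum_const, nsmul_eq_mul, mul_comm]

namespace BlockProc

lemma urnAvg_out_leaf (c : Option Bool → ℝ) (k : β → Option (Option Bool)) (g : ℝ) :
    urnAvg c k (leaf g).out = g * urnWt c k := urnAvg_const c k g

lemma urnAvg_out_node (c : Option Bool → ℝ) {k : β → Option (Option Bool)} {i : β}
    (hi : k i = none) (f : Option Bool → BlockProc β) :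
    urnAvg c k (node i f).out = ∑ s, urnAvg c (Function.update k i (some s)) (f s).out := by
  rw [urnAvg_split c hi]
  refine Finset.sum_congr rfl fun s _ => urnAvg_congr c fun z hz => ?_
  rw [out, ((extends_update hi s z).1 hz).2]

lemma urnAvg_touches_node (c : Option Bool → ℝ) {k : β → Option (Option Bool)} {i : β}
    (hi : k i = none) (f : Option Bool → BlockProc β) :
    urnAvg c k (node i f).touches =
      urnWt c k + ∑ s, urnAvg c (Function.update k i (some s)) (f s).touches := by
  rw [urnAvg_split c hi, urnWt, urnAvg_split c hi, ← Finset.sum_add_distrib]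
  refine Finset.sum_congr rfl fun s _ => ?_
  rw [← urnAvg_add]
  refine urnAvg_congr c fun z hz => ?_
  rw [touches, ((extends_update hi s z).1 hz).2, add_comm]

lemma urnAvg_touches_nonneg (c : Option Bool → ℝ) (k : β → Option (Option Bool))
    (A : BlockProc β) : 0 ≤ urnAvg c k A.touches :=
  urnAvg_nonneg c k A.touches_nonneg

end BlockProc

end Urn

/-! ### Hellinger distance -/

/-- The squared Hellinger distance of two weights. -/
noncomputable def hell (x y : ℝ) : ℝ := x + y - 2 * √(x * y)

lemma hell_eq {x y : ℝ} (hx : 0 ≤ x) (hy : 0 ≤ y) : hell x y = (√x - √y) ^ 2 := by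
  unfold hell
  rw [Real.sqrt_mul hx, sub_sq, Real.sq_sqrt hx, Real.sq_sqrt hy]; ring

lemma hell_nonneg {x y : ℝ} (hx : 0 ≤ x) (hy : 0 ≤ y) : 0 ≤ hell x y := by
  rw [hell_eq hx hy]; positivity

lemma hell_self {x : ℝ} (hx : 0 ≤ x) : hell x x = 0 := by
  rw [hell_eq hx hx]; simp

/-- With `a = √x` and `b = √y`, `|x - y| = |a - b| * (a + b)`, and a weighted arithmetic-geometric
mean inequality applies. The parameter `α` trades the Hellinger part, which grows with the number of
draws, against a fixed loss. -/
lemma abs_sub_le_hell {x y α : ℝ} (hx : 0 ≤ x) (hy : 0 ≤ y) (hα : 0 < α) :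
    |x - y| ≤ α * hell x y + (x + y) / (2 * α) := by
  rw [hell_eq hx hy]
  have hx' := Real.sq_sqrt hx
  have hy' := Real.sq_sqrt hy
  set a := √x
  set b := √y
  have key : ∀ u v : ℝ, 2 * α * (u * v) ≤ α * (α * u ^ 2) * 2 + v ^ 2 / 2 := by
    intro u v; nlinarith [sq_nonneg (2 * α * u - v)]
  have h1 : |x - y| * (2 * α) ≤ α * (a - b) ^ 2 * (2 * α) + (x + y) := by
    rw [← hx', ← hy']
    rcases abs_cases (a ^ 2 - b ^ 2) with ⟨h, _⟩ | ⟨h, _⟩ <;> rw [h]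
    · nlinarith [key (a - b) (a + b), sq_nonneg (a - b)]
    · nlinarith [key (b - a) (a + b), sq_nonneg (a - b)]
  have h2 : |x - y| ≤ (α * (a - b) ^ 2 * (2 * α) + (x + y)) / (2 * α) :=
    (le_div_iff₀ (by positivity)).2 h1
  rwa [add_div, mul_div_assoc, div_self (by positivity), mul_one] at h2

/-- The left side is the harmonic mean of `p` and `q`, which is at most their geometric mean. -/
lemma half_add_sub_le_sqrt_mul {p q : ℝ} (hp : 0 ≤ p) (hq : 0 ≤ q) (h : 0 < p + q) :
    (p + q) / 2 - (p - q) ^ 2 / (2 * (p + q)) ≤ √(p * q) := by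
  have : (p + q) / 2 - (p - q) ^ 2 / (2 * (p + q)) = 2 * (p * q) / (p + q) := by
    field_simp; ring
  rw [this]
  apply Real.le_sqrt_of_sq_le
  rw [div_pow, div_le_iff₀ (by positivity)]
  nlinarith [mul_nonneg (mul_nonneg hp hq) (sq_nonneg (p - q))]

/-! ### Telling apart two urns with equally many hard blocks -/

section Urn

variable {β : Type} [Fintype β] [DecidableEq β]

/-- Revealing one more symbol increases the Hellinger distance of two urns only slightly. -/
lemma sum_hell_update_le {c c' : Option Bool → ℝ} {d : ℝ} {k : β → Option (Option Bool)} {i : β}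
    (hi : k i = none) (hn : c none = c' none)
    (hd : ∀ b, |c (some b) - c' (some b)| ≤ d)
    (hc : ∀ b, 3 * (Fintype.card β : ℝ) / 8 ≤ c (some b))
    (hc' : ∀ b, 3 * (Fintype.card β : ℝ) / 8 ≤ c' (some b))
    (ht : (known k : ℝ) ≤ Fintype.card β / 16) :
    ∑ s, hell (urnWt c (Function.update k i (some s))) (urnWt c' (Function.update k i (some s))) ≤
      hell (urnWt c k) (urnWt c' k) +
        (urnWt c k + urnWt c' k) * (2 * (d / Fintype.card β) ^ 2) := by
  have hB : (0 : ℝ) < Fintype.card β := by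
    exact_mod_cast (Nat.zero_le _).trans_lt (known_lt hi)
  set B : ℝ := (Fintype.card β : ℝ)
  have hN : 0 < B - known k := by linarith
  set N := B - known k with hNdef
  set x := urnWt c k with hx
  set y := urnWt c' k with hy
  have hx0 : 0 ≤ x := urnWt_nonneg _ _
  have hy0 : 0 ≤ y := urnWt_nonneg _ _
  set xs := fun s => urnWt c (Function.update k i (some s)) with hxs
  set ys := fun s => urnWt c' (Function.update k i (some s)) with hys
  have hxs0 : ∀ s, 0 ≤ xs s := fun s => urnWt_nonneg _ _
  have hys0 : ∀ s, 0 ≤ ys s := fun s => urnWt_nonneg _ _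
  have hsx : ∑ s, xs s = x := (urnAvg_split c hi _).symm
  have hsy : ∑ s, ys s = y := (urnAvg_split c' hi _).symm
  have hstepx : ∀ s, xs s * N = (c s - seen k s) * x := fun s => urnWt_update_mul c hi s
  have hstepy : ∀ s, ys s * N = (c' s - seen k s) * y := fun s => urnWt_update_mul c' hi s
  have hd0 : 0 ≤ d := (abs_nonneg _).trans (hd true)
  -- The children's masses add up to `x` and `y`, so only the affinity `√(x * y)` can change. It
  -- loses at most the relative amount `2 * (d / B) ^ 2`.
  suffices h : √(x * y) * (1 - 2 * (d / B) ^ 2) ≤ ∑ s, √(xs s * ys s) by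
    have h1 : ∑ s, hell (xs s) (ys s) = x + y - 2 * ∑ s, √(xs s * ys s) := by
      unfold hell
      rw [Finset.sum_sub_distrib, Finset.sum_add_distrib, hsx, hsy, Finset.mul_sum]
    have h2 : 2 * √(x * y) ≤ x + y := by
      have := hell_nonneg hx0 hy0
      unfold hell at this; linarith
    rw [h1]
    unfold hell
    nlinarith [mul_le_mul_of_nonneg_right h2 (by positivity : 0 ≤ 2 * (d / B) ^ 2)]
  rcases hx0.eq_or_lt with h0 | hxp
  · rw [← h0]; simp only [zero_mul, Real.sqrt_zero]
    exact Finset.sum_nonneg fun s _ => Real.sqrt_nonneg _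
  rcases hy0.eq_or_lt with h0 | hyp
  · rw [← h0]; simp only [mul_zero, zero_mul, Real.sqrt_zero]
    exact Finset.sum_nonneg fun s _ => Real.sqrt_nonneg _
  set p := fun s => (c s - seen k s) / N with hp
  set q := fun s => (c' s - seen k s) / N with hq
  have hxp' : ∀ s, xs s = p s * x := by
    intro s; rw [hp]; simp only; rw [div_mul_eq_mul_div, eq_div_iff hN.ne', hstepx]
  have hyq' : ∀ s, ys s = q s * y := by
    intro s; rw [hq]; simp only; rw [div_mul_eq_mul_div, eq_div_iff hN.ne', hstepy]
  have hp0 : ∀ s, 0 ≤ p s := fun s => nonneg_of_mul_nonneg_left (hxp' s ▸ hxs0 s) hxp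
  have hq0 : ∀ s, 0 ≤ q s := fun s => nonneg_of_mul_nonneg_left (hyq' s ▸ hys0 s) hyp
  have hp1 : ∑ s, p s = 1 := by
    have : (∑ s, p s) * x = 1 * x := by
      rw [Finset.sum_mul, one_mul, ← Finset.sum_congr rfl fun s _ => hxp' s, hsx]
    exact mul_right_cancel₀ hxp.ne' this
  have hq1 : ∑ s, q s = 1 := by
    have : (∑ s, q s) * y = 1 * y := by
      rw [Finset.sum_mul, one_mul, ← Finset.sum_congr rfl fun s _ => hyq' s, hsy]
    exact mul_right_cancel₀ hyp.ne' this
  have hroot : ∀ s, √(xs s * ys s) = √(x * y) * √(p s * q s) := by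
    intro s
    rw [hxp', hyq', ← Real.sqrt_mul (by positivity)]
    congr 1; ring
  -- The hard symbol has the same conditional probability in both urns and loses nothing; each easy
  -- symbol loses at most `(d / B) ^ 2`.
  have hsn : √(p none * q none) = (p none + q none) / 2 := by
    have : q none = p none := by simp only [hp, hq, hn]
    rw [this, Real.sqrt_mul_self (hp0 _)]; ring
  have hss : ∀ b, (p (some b) + q (some b)) / 2 - (d / B) ^ 2 ≤ √(p (some b) * q (some b)) := by
    intro b
    have hseen : (seen k (some b) : ℝ) ≤ B / 16 := by
      refine le_trans ?_ ht
      rw [← sum_seen]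
      exact_mod_cast Finset.single_le_sum (f := seen k) (fun _ _ => Nat.zero_le _)
        (Finset.mem_univ (some b))
    -- The two counts sum to at least `6 * B / 8`, and the known blocks remove at most `B / 8`.
    -- Since `N ≥ 15 * B / 16`, the loss is at most `(16 / 15) ^ 2 / (2 * 5 / 8) < 1` times `(d / B)
    -- ^ 2`.
    have hpq : 5 / 8 ≤ p (some b) + q (some b) := by
      simp only [hp, hq]
      rw [← add_div, le_div_iff₀ hN]
      have h1 := hc b
      have h2 := hc' b
      have h3 : (0 : ℝ) ≤ known k := Nat.cast_nonneg _
      linarith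
    have hdiff : (p (some b) - q (some b)) ^ 2 ≤ (16 / 15 * (d / B)) ^ 2 := by
      have h4 : p (some b) - q (some b) = (c (some b) - c' (some b)) / N := by
        simp only [hp, hq]; ring
      refine sq_le_sq.2 (le_trans ?_ (le_abs_self _))
      rw [h4, abs_div, abs_of_pos hN]
      rw [div_le_iff₀ hN]
      refine (hd b).trans ?_
      have h5 : 15 / 16 * B ≤ N := by linarith
      calc d = 16 / 15 * (d / B) * (15 / 16 * B) := by field_simp
        _ ≤ _ := by gcongr
    refine le_trans ?_ (half_add_sub_le_sqrt_mul (hp0 _) (hq0 _) (by linarith))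
    gcongr
    rw [div_le_iff₀ (by linarith)]
    nlinarith [sq_nonneg (d / B)]
  simp only [hroot]
  rw [← Finset.mul_sum]
  refine mul_le_mul_of_nonneg_left ?_ (Real.sqrt_nonneg _)
  rw [Fintype.sum_option, Fintype.sum_bool] at hp1 hq1 ⊢
  rw [hsn]
  linarith [hss true, hss false]

namespace BlockProc

/-- Comparison of the expected outputs on two urns with the same number of hard blocks. -/
lemma abs_sub_urnAvg_out_le {c c' : Option Bool → ℝ} {d α K : ℝ} (hn : c none = c' none)
    (hd : ∀ b, |c (some b) - c' (some b)| ≤ d)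
    (hc : ∀ b, 3 * (Fintype.card β : ℝ) / 8 ≤ c (some b))
    (hc' : ∀ b, 3 * (Fintype.card β : ℝ) / 8 ≤ c' (some b))
    (hα : 0 < α) (hK : 16 ≤ K * Fintype.card β)
    (hαK : α * (2 * (d / Fintype.card β) ^ 2) ≤ K)
    (A : BlockProc β) (k : β → Option (Option Bool)) (hA : A.Fresh k) :
    |urnAvg c k A.out - urnAvg c' k A.out| ≤
      α * hell (urnWt c k) (urnWt c' k) + (urnWt c k + urnWt c' k) / (2 * α) +
        K * (known k * (urnWt c k + urnWt c' k) +
          2 * (urnAvg c k A.touches + urnAvg c' k A.touches)) := by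
  have hK0 : 0 < K := by
    have : (0 : ℝ) ≤ Fintype.card β := Nat.cast_nonneg _
    by_contra h
    nlinarith [mul_nonneg (sub_nonneg.2 (not_lt.1 h)) this]
  induction A generalizing k with
  | leaf g =>
    have hx := urnWt_nonneg c k
    have hy := urnWt_nonneg c' k
    have h1 := abs_sub_le_hell hx hy hα
    have h2 := urnAvg_touches_nonneg c k (leaf g)
    have h3 := urnAvg_touches_nonneg c' k (leaf g)
    rw [urnAvg_out_leaf, urnAvg_out_leaf, ← mul_sub, abs_mul]
    have h4 : |g| * |urnWt c k - urnWt c' k| ≤ 1 * |urnWt c k - urnWt c' k| :=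
      mul_le_mul_of_nonneg_right hA (abs_nonneg _)
    have h5 : 0 ≤ K * (known k * (urnWt c k + urnWt c' k) +
          2 * (urnAvg c k (leaf g).touches + urnAvg c' k (leaf g).touches)) := by positivity
    linarith
  | node i f ih =>
    have hx := urnWt_nonneg c k
    have hy := urnWt_nonneg c' k
    by_cases ht : (known k : ℝ) ≤ Fintype.card β / 16
    -- A touch is charged `2 * K`: one `K` pays for the rise of `known`, the other for the growth of
    -- the Hellinger term.
    · have hi := hA.1
      have hstep := sum_hell_update_le hi hn hd hc hc' ht
      have hsx : urnWt c k = ∑ s, urnWt c (Function.update k i (some s)) := urnAvg_split c hi _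
      have hsy : urnWt c' k = ∑ s, urnWt c' (Function.update k i (some s)) := urnAvg_split c' hi _
      rw [urnAvg_out_node c hi, urnAvg_out_node c' hi, urnAvg_touches_node c hi,
        urnAvg_touches_node c' hi, ← Finset.sum_sub_distrib]
      refine (Finset.abs_sum_le_sum_abs _ _).trans
        ((Finset.sum_le_sum fun s _ => ih s _ (hA.2 s)).trans ?_)
      simp only [known_update hi, Finset.sum_add_distrib, ← Finset.mul_sum, ← Finset.sum_div,
        ← hsx, ← hsy]
      have h6 := mul_le_mul_of_nonneg_left hstep hα.le
      have h7 := mul_le_mul_of_nonneg_right hαK (add_nonneg hx hy)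
      push_cast
      nlinarith
    -- Once more than a sixteenth of the blocks is known, `K * known k ≥ 1` and the trivial bound
    -- suffices.
    · have h1 := abs_urnAvg_le c k ((node i f).abs_out_le k hA)
      have h2 := abs_urnAvg_le c' k ((node i f).abs_out_le k hA)
      have h3 := urnAvg_touches_nonneg c k (node i f)
      have h4 := urnAvg_touches_nonneg c' k (node i f)
      have h5 : 0 ≤ α * hell (urnWt c k) (urnWt c' k) := mul_nonneg hα.le (hell_nonneg hx hy)
      have h6 : 0 ≤ (urnWt c k + urnWt c' k) / (2 * α) := by positivity
      have h7 : 1 ≤ K * known k := by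
        push Not at ht
        nlinarith
      have h8 := abs_sub (urnAvg c k (node i f).out) (urnAvg c' k (node i f).out)
      have h9 : 0 ≤ K * (2 * (urnAvg c k (node i f).touches + urnAvg c' k (node i f).touches)) := by
        positivity
      nlinarith [mul_le_mul_of_nonneg_right h7 (add_nonneg hx hy)]

end BlockProc

end Urn

/-! ### The four hard urns and the cancellation -/

/-- Numbers of blocks of each symbol in the hard inputs of value `v`: without hard blocks (`h` is
`false`) or with hard blocks (`h` is `true`), all of value `v`. -/
noncomputable def hardCounts (m : ℕ) (h v : Bool) : Option Bool → ℝ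
  | none => if h then 32 * (m : ℝ) ^ 15 else 0
  | some s =>
    -- The easy margin is `16 * m ^ 15` against `v` with hard blocks and `16 * m ^ 14` towards `v`
    -- without them. The ratio `m` drives the cancellation. The `32 * m ^ 15` hard blocks restore
    -- the majority of `v`.
    if h then (if s = v then 4 * (m : ℝ) ^ 18 - 24 * (m : ℝ) ^ 15
      else 4 * (m : ℝ) ^ 18 - 8 * (m : ℝ) ^ 15)
    else (if s = v then 4 * (m : ℝ) ^ 18 + 8 * (m : ℝ) ^ 14
      else 4 * (m : ℝ) ^ 18 - 8 * (m : ℝ) ^ 14)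

/-- The extra `m ^ 2` leaves room for the blocks already drawn in the first phase. -/
lemma hardCounts_lower {m : ℕ} (hm : 1000 ≤ (m : ℝ)) (h v b : Bool) :
    3 * (m : ℝ) ^ 18 + (m : ℝ) ^ 2 ≤ hardCounts m h v (some b) := by
  have h0 : (0 : ℝ) < m := by linarith
  have h1 : (24 : ℝ) * m ^ 15 ≤ m ^ 18 / 2 := by
    have : (1000 : ℝ) ^ 3 * m ^ 15 ≤ m ^ 3 * m ^ 15 := by gcongr
    have e : (m : ℝ) ^ 3 * m ^ 15 = m ^ 18 := by ring
    have : 0 < (m : ℝ) ^ 15 := by positivity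
    linarith
  have h2 : (m : ℝ) ^ 14 ≤ m ^ 15 := pow_le_pow_right₀ (by linarith) (by norm_num)
  have h3 : (m : ℝ) ^ 2 ≤ m ^ 15 := pow_le_pow_right₀ (by linarith) (by norm_num)
  have h4 : 0 < (m : ℝ) ^ 14 := by positivity
  unfold hardCounts
  simp only
  split_ifs <;> linarith

/-- Together with `hardCounts_lower` this bounds the likelihood ratio of one easy symbol by `1 + 48
* m ^ 15 / (3 * m ^ 18) = 1 + 16 / m ^ 3`. -/
lemma hardCounts_sub_le {m : ℕ} (hm : 1000 ≤ (m : ℝ)) (h v h' v' b : Bool) :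
    hardCounts m h v (some b) - hardCounts m h' v' (some b) ≤ 48 * (m : ℝ) ^ 15 := by
  have h2 : (m : ℝ) ^ 14 ≤ m ^ 15 := pow_le_pow_right₀ (by linarith) (by norm_num)
  have h4 : 0 < (m : ℝ) ^ 14 := by positivity
  unfold hardCounts
  simp only
  split_ifs <;> linarith

/-- One step of the signed combination of the weights of the four hard distributions. -/
lemma abs_signed_step_le {M N a b c d a₁ b₁ c₁ d₁ a₀ b₀ c₀ d₀ r₁ r₀ W : ℝ} (hM : 1000 ≤ M)
    (hr₁ : 0 ≤ r₁) (hr₀ : 0 ≤ r₀) (hr : r₁ + r₀ ≤ M ^ 2) (hN : N = 8 * M ^ 18 - (r₁ + r₀))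
    (ha₁ : a₁ * N = (4 * M ^ 18 + 8 * M ^ 14 - r₁) * a)
    (hb₁ : b₁ * N = (4 * M ^ 18 - 8 * M ^ 14 - r₁) * b)
    (hc₁ : c₁ * N = (4 * M ^ 18 - 24 * M ^ 15 - r₁) * c)
    (hd₁ : d₁ * N = (4 * M ^ 18 - 8 * M ^ 15 - r₁) * d)
    (ha₀ : a₀ * N = (4 * M ^ 18 - 8 * M ^ 14 - r₀) * a)
    (hb₀ : b₀ * N = (4 * M ^ 18 + 8 * M ^ 14 - r₀) * b)
    (hc₀ : c₀ * N = (4 * M ^ 18 - 8 * M ^ 15 - r₀) * c)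
    (hd₀ : d₀ * N = (4 * M ^ 18 - 24 * M ^ 15 - r₀) * d)
    (hE : |(a + b) - (c + d)| ≤ 32 / M * W) (hF : |c - d| ≤ 32 / M * W) :
    |M * (a₁ - b₁) + (c₁ - d₁)| + |M * (a₀ - b₀) + (c₀ - d₀)| ≤
      |M * (a - b) + (c - d)| + 220 / M ^ 4 * W := by
  have hM0 : 0 < M := by linarith
  have hM2 : M ^ 2 ≤ M ^ 18 := pow_le_pow_right₀ (by linarith) (by norm_num)
  have hM18 : 0 < M ^ 18 := by positivity
  have hN7 : 7 * M ^ 18 ≤ N := by linarith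
  have hN0 : 0 < N := by linarith
  have hW : 0 ≤ W := by
    have : 0 ≤ 32 / M * W := (abs_nonneg _).trans hE
    exact nonneg_of_mul_nonneg_right this (by positivity)
  set E := (a + b) - (c + d) with hEdef
  set F := c - d with hFdef
  set D := M * (a - b) + F with hDdef
  -- The terms `M * 8 * M ^ 14 * (a + b)` and `-8 * M ^ 15 * (c + d)` combine to a multiple of `E`.
  -- Only `E` and `F` disturb the evolution of `D`, and both are smaller than the weights by a
  -- factor of order `1 / M`.
  have e1 : (M * (a₁ - b₁) + (c₁ - d₁)) * N =
      (4 * M ^ 18 - r₁) * D + 8 * M ^ 15 * E + -(16 * M ^ 15) * F := by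
    have : (M * (a₁ - b₁) + (c₁ - d₁)) * N = M * (a₁ * N - b₁ * N) + (c₁ * N - d₁ * N) := by ring
    rw [this, ha₁, hb₁, hc₁, hd₁, hDdef, hEdef, hFdef]; ring
  have e0 : (M * (a₀ - b₀) + (c₀ - d₀)) * N =
      (4 * M ^ 18 - r₀) * D + -(8 * M ^ 15) * E + -(16 * M ^ 15) * F := by
    have : (M * (a₀ - b₀) + (c₀ - d₀)) * N = M * (a₀ * N - b₀ * N) + (c₀ * N - d₀ * N) := by ring
    rw [this, ha₀, hb₀, hc₀, hd₀, hDdef, hEdef, hFdef]; ring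
  have hM15 : 0 < M ^ 15 := by positivity
  have bd : ∀ r u : ℝ, 0 ≤ r → r ≤ M ^ 2 → |u| = 8 * M ^ 15 →
      |(4 * M ^ 18 - r) * D + u * E + -(16 * M ^ 15) * F| ≤
        (4 * M ^ 18 - r) * |D| + 24 * M ^ 15 * (32 / M * W) := by
    intro r u hr0 hr2 hu
    refine (abs_add_le _ _).trans ?_
    refine (add_le_add_left (abs_add_le _ _) _).trans ?_
    rw [abs_mul, abs_mul, abs_mul, hu, abs_neg, abs_of_pos (by positivity : 0 < 16 * M ^ 15),
      abs_of_nonneg (by linarith : 0 ≤ 4 * M ^ 18 - r)]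
    nlinarith [mul_le_mul_of_nonneg_left hE hM15.le, mul_le_mul_of_nonneg_left hF hM15.le]
  have b1 := bd r₁ (8 * M ^ 15) hr₁ (by linarith) (abs_of_pos (by positivity))
  have b0 := bd r₀ (-(8 * M ^ 15)) hr₀ (by linarith)
    (by rw [abs_neg]; exact abs_of_pos (by positivity))
  rw [← e1, abs_mul, abs_of_pos hN0] at b1
  rw [← e0, abs_mul, abs_of_pos hN0] at b0
  -- Two errors of `24 * M ^ 15 * (32 / M * W)`, divided by `N ≥ 7 * M ^ 18`; `1536 / 7 < 220`.
  have e3 : 48 * M ^ 15 * (32 / M * W) = 1536 / 7 / M ^ 4 * W * (7 * M ^ 18) := by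
    field_simp; ring
  have e4 : 1536 / 7 / M ^ 4 * W * (7 * M ^ 18) ≤ 220 / M ^ 4 * W * N := by
    gcongr; norm_num
  refine le_of_mul_le_mul_right ?_ hN0
  rw [add_mul, add_mul]
  -- The coefficients of the two symbols add up to `N`, so `|D|` itself is not amplified.
  have e5 : (4 * M ^ 18 - r₁) * |D| + (4 * M ^ 18 - r₀) * |D| = |D| * N := by rw [hN]; ring
  linarith

/-- Over at most `m ^ 2` easy draws the likelihood ratios of the four urns stay within `1 + O(1 /
m)`. -/
lemma one_add_pow_le {M : ℝ} (hM : 1000 ≤ M) {t : ℕ} (ht : (t : ℝ) ≤ M ^ 2) :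
    (1 + 16 / M ^ 3) ^ t ≤ 1 + 32 / M := by
  have hM0 : 0 < M := by linarith
  have h1 : (1 + 16 / M ^ 3) ^ t ≤ Real.exp (16 / M ^ 3 * t) := by
    rw [mul_comm, Real.exp_nat_mul]
    gcongr
    rw [add_comm]
    exact Real.add_one_le_exp _
  have h2 : 16 / M ^ 3 * t ≤ 16 / M := by
    calc 16 / M ^ 3 * t ≤ 16 / M ^ 3 * M ^ 2 := by gcongr
      _ = 16 / M := by field_simp
  have h3 : 16 / M ≤ 1 / 2 := by rw [div_le_iff₀ hM0]; linarith
  have h5 : 0 < 16 / M := by positivity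
  have h4 : Real.exp (16 / M) ≤ 1 / (1 - 16 / M) :=
    Real.exp_bound_div_one_sub_of_interval h5.le (by linarith)
  refine h1.trans ((Real.exp_le_exp.2 h2).trans (h4.trans ?_))
  rw [div_le_iff₀ (by linarith)]
  have : 32 / M = 2 * (16 / M) := by ring
  rw [this]
  nlinarith

/-! ### Advantage of block procedures on the hard urns -/

section Urn

variable {β : Type} [Fintype β] [DecidableEq β]

lemma known_le_of_le {m : ℕ} (hm : 1000 ≤ (m : ℝ)) (hβ : (Fintype.card β : ℝ) = 8 * (m : ℝ) ^ 18)
    {t : ℝ} (ht : t ≤ (m : ℝ) ^ 2) : t ≤ (Fintype.card β : ℝ) / 16 := by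
  have : (m : ℝ) ^ 2 * 2 ≤ m ^ 2 * m ^ 16 := by
    gcongr
    have : (m : ℝ) ^ 1 ≤ m ^ 16 := pow_le_pow_right₀ (by linarith) (by norm_num)
    linarith
  rw [hβ]; nlinarith

lemma hardCounts_ge_card {m : ℕ} (hm : 1000 ≤ (m : ℝ))
    (hβ : (Fintype.card β : ℝ) = 8 * (m : ℝ) ^ 18) (h v b : Bool) :
    3 * (Fintype.card β : ℝ) / 8 ≤ hardCounts m h v (some b) := by
  have := hardCounts_lower hm h v b
  rw [hβ]
  have : 0 ≤ (m : ℝ) ^ 2 := by positivity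
  linarith

lemma abs_hardCounts_sub_false (m : ℕ) (b : Bool) :
    |hardCounts m false true (some b) - hardCounts m false false (some b)| ≤ 16 * (m : ℝ) ^ 14 := by
  have : (0 : ℝ) ≤ (m : ℝ) ^ 14 := by positivity
  cases b <;> simp [hardCounts] <;> rw [abs_le] <;> constructor <;> linarith

lemma abs_hardCounts_sub_true (m : ℕ) (b : Bool) :
    |hardCounts m true true (some b) - hardCounts m true false (some b)| ≤ 16 * (m : ℝ) ^ 15 := by
  have : (0 : ℝ) ≤ (m : ℝ) ^ 15 := by positivity
  cases b <;> simp [hardCounts] <;> rw [abs_le] <;> constructor <;> linarith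

lemma hardCounts_none (m : ℕ) (h v v' : Bool) :
    hardCounts m h v none = hardCounts m h v' none := rfl

namespace BlockProc

/-- Inputs without hard blocks of the two values are hard to tell apart. -/
lemma abs_sub_le_of_no_hard {m : ℕ} (hm : 1000 ≤ (m : ℝ))
    (hβ : (Fintype.card β : ℝ) = 8 * (m : ℝ) ^ 18)
    (A : BlockProc β) (k : β → Option (Option Bool)) (hA : A.Fresh k) :
    |urnAvg (hardCounts m false true) k A.out - urnAvg (hardCounts m false false) k A.out| ≤
      (m : ℝ) ^ 3 / 2 *
        hell (urnWt (hardCounts m false true) k) (urnWt (hardCounts m false false) k) +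
      (urnWt (hardCounts m false true) k + urnWt (hardCounts m false false) k) / (m : ℝ) ^ 3 +
      4 / (m : ℝ) ^ 5 * (known k *
          (urnWt (hardCounts m false true) k + urnWt (hardCounts m false false) k) +
        2 * (urnAvg (hardCounts m false true) k A.touches +
          urnAvg (hardCounts m false false) k A.touches)) := by
  have hm0 : (0 : ℝ) < m := by linarith
  -- Here `d / B = 2 / m ^ 4`, so this `α` gives `K = 2 * α * (d / B) ^ 2 = 4 / m ^ 5`. After
  -- multiplication by `m` the price of a draw is of order `1 / m ^ 4` and the fixed loss of order
  -- `1 / m ^ 2`.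
  have h := abs_sub_urnAvg_out_le (hardCounts_none m false true false)
    (abs_hardCounts_sub_false m) (hardCounts_ge_card hm hβ false true)
    (hardCounts_ge_card hm hβ false false) (α := (m : ℝ) ^ 3 / 2) (K := 4 / (m : ℝ) ^ 5)
    (by positivity) ?_ ?_ A k hA
  · rwa [mul_div_cancel₀ _ (two_ne_zero)] at h
  · rw [hβ]
    have : 4 / (m : ℝ) ^ 5 * (8 * m ^ 18) = 32 * m ^ 13 := by field_simp; ring
    rw [this]
    have : (1 : ℝ) ≤ m ^ 13 := one_le_pow₀ (by linarith)
    linarith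
  · rw [hβ]
    apply le_of_eq; field_simp; ring

/-- Inputs with hard blocks of the two values are hard to tell apart. -/
lemma abs_sub_le_of_hard {m : ℕ} (hm : 1000 ≤ (m : ℝ))
    (hβ : (Fintype.card β : ℝ) = 8 * (m : ℝ) ^ 18)
    (A : BlockProc β) (k : β → Option (Option Bool)) (hA : A.Fresh k) :
    |urnAvg (hardCounts m true true) k A.out - urnAvg (hardCounts m true false) k A.out| ≤
      (m : ℝ) ^ 2 / 2 *
        hell (urnWt (hardCounts m true true) k) (urnWt (hardCounts m true false) k) +
      (urnWt (hardCounts m true true) k + urnWt (hardCounts m true false) k) / (m : ℝ) ^ 2 +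
      4 / (m : ℝ) ^ 4 * (known k *
          (urnWt (hardCounts m true true) k + urnWt (hardCounts m true false) k) +
        2 * (urnAvg (hardCounts m true true) k A.touches +
          urnAvg (hardCounts m true false) k A.touches)) := by
  have hm0 : (0 : ℝ) < m := by linarith
  -- Here `d / B = 2 / m ^ 3`; this `α` again yields a price of order `1 / m ^ 4` and a fixed loss
  -- of order `1 / m ^ 2`.
  have h := abs_sub_urnAvg_out_le (hardCounts_none m true true false)
    (abs_hardCounts_sub_true m) (hardCounts_ge_card hm hβ true true)
    (hardCounts_ge_card hm hβ true false) (α := (m : ℝ) ^ 2 / 2) (K := 4 / (m : ℝ) ^ 4)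
    (by positivity) ?_ ?_ A k hA
  · rwa [mul_div_cancel₀ _ (two_ne_zero)] at h
  · rw [hβ]
    have : 4 / (m : ℝ) ^ 4 * (8 * m ^ 18) = 32 * m ^ 14 := by field_simp; ring
    rw [this]
    have : (1 : ℝ) ≤ m ^ 14 := one_le_pow₀ (by linarith)
    linarith
  · rw [hβ]
    apply le_of_eq; field_simp; ring

/-- The main estimate: the advantages on inputs without and with hard blocks, combined so that the
first-order contributions of the easy blocks cancel. -/
lemma abs_combined_le {m : ℕ} (hm : 1000 ≤ (m : ℝ))
    (hβ : (Fintype.card β : ℝ) = 8 * (m : ℝ) ^ 18)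
    (A : BlockProc β) (k : β → Option (Option Bool)) (hA : A.Fresh k) (hk : seen k none = 0)
    (ht : known k ≤ m ^ 2)
    (hw : ∀ h v h' v', urnWt (hardCounts m h v) k ≤
      (1 + 16 / (m : ℝ) ^ 3) ^ known k * urnWt (hardCounts m h' v') k) :
    |m * (urnAvg (hardCounts m false true) k A.out - urnAvg (hardCounts m false false) k A.out) +
      (urnAvg (hardCounts m true true) k A.out - urnAvg (hardCounts m true false) k A.out)| ≤
    |m * (urnWt (hardCounts m false true) k - urnWt (hardCounts m false false) k) +
      (urnWt (hardCounts m true true) k - urnWt (hardCounts m true false) k)| +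
    (m : ℝ) ^ 4 / 2 *
      hell (urnWt (hardCounts m false true) k) (urnWt (hardCounts m false false) k) +
    (m : ℝ) ^ 2 / 2 *
      hell (urnWt (hardCounts m true true) k) (urnWt (hardCounts m true false) k) +
    1000 / (m : ℝ) ^ 4 * (known k * ∑ h, ∑ v, urnWt (hardCounts m h v) k +
      2 * ∑ h, ∑ v, urnAvg (hardCounts m h v) k A.touches) := by
  have hm0 : (0 : ℝ) < m := by linarith
  have hwt : ∀ h v k, 0 ≤ urnWt (β := β) (hardCounts m h v) k := fun h v k => urnWt_nonneg _ _
  have hT : ∀ h v k (A : BlockProc β), 0 ≤ urnAvg (hardCounts m h v) k A.touches :=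
    fun h v k A => urnAvg_touches_nonneg _ _ _
  -- The signed combination of weights is the main potential. The Hellinger terms are carried along
  -- with the coefficients `m * (m ^ 3 / 2)` and `m ^ 2 / 2` that `abs_sub_le_of_no_hard` and
  -- `abs_sub_le_of_hard` need whenever the first phase ends.
  induction A generalizing k with
  | leaf g =>
    simp only [urnAvg_out_leaf]
    have h1 : m * (g * urnWt (hardCounts m false true) k - g * urnWt (hardCounts m false false) k) +
        (g * urnWt (hardCounts m true true) k - g * urnWt (hardCounts m true false) k) =
        g * (m * (urnWt (hardCounts m false true) k - urnWt (hardCounts m false false) k) +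
      (urnWt (hardCounts m true true) k - urnWt (hardCounts m true false) k)) := by ring
    rw [h1, abs_mul]
    have h2 := mul_le_mul_of_nonneg_right hA (abs_nonneg
      (m * (urnWt (hardCounts m false true) k - urnWt (hardCounts m false false) k) +
      (urnWt (hardCounts m true true) k - urnWt (hardCounts m true false) k)))
    have h3 := hell_nonneg (hwt false true k) (hwt false false k)
    have h4 := hell_nonneg (hwt true true k) (hwt true false k)
    have h5 : 0 ≤ ∑ h, ∑ v, urnWt (hardCounts m h v) k :=
      Finset.sum_nonneg fun h _ => Finset.sum_nonneg fun v _ => hwt h v k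
    have h6 : 0 ≤ ∑ h, ∑ v, urnAvg (hardCounts m h v) k (leaf g).touches :=
      Finset.sum_nonneg fun h _ => Finset.sum_nonneg fun v _ => hT h v k _
    have h7 : 0 ≤ (m : ℝ) ^ 4 / 2 *
      hell (urnWt (hardCounts m false true) k) (urnWt (hardCounts m false false) k) := by positivity
    have h8 : 0 ≤ (m : ℝ) ^ 2 / 2 *
      hell (urnWt (hardCounts m true true) k) (urnWt (hardCounts m true false) k) := by positivity
    have h9 : 0 ≤ 1000 / (m : ℝ) ^ 4 * (known k * ∑ h, ∑ v, urnWt (hardCounts m h v) k +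
      2 * ∑ h, ∑ v, urnAvg (hardCounts m h v) k (leaf g).touches) := by positivity
    linarith
  | node i f ih =>
    rcases ht.eq_or_lt with hte | htl
    · -- the second phase: the two kinds of inputs are treated separately
      have hX := abs_sub_le_of_no_hard hm hβ _ k hA
      have hY := abs_sub_le_of_hard hm hβ _ k hA
      have hX' := mul_le_mul_of_nonneg_left hX hm0.le
      have hte' : (known k : ℝ) = (m : ℝ) ^ 2 := by exact_mod_cast hte
      -- With `m ^ 2` blocks known, the fixed losses of order `1 / m ^ 2` are covered by the charge
      -- for `known k`.
      rw [hte'] at hX' hY ⊢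
      refine (abs_add_le _ _).trans ?_
      rw [abs_mul, abs_of_pos hm0]
      refine (add_le_add hX' hY).trans ?_
      have h5 := abs_nonneg (m * (urnWt (hardCounts m false true) k -
        urnWt (hardCounts m false false) k) +
        (urnWt (hardCounts m true true) k - urnWt (hardCounts m true false) k))
      simp only [Fintype.sum_bool]
      have a1 := hwt false true k
      have a2 := hwt false false k
      have a3 := hwt true true k
      have a4 := hwt true false k
      have a5 := hT false true k (node i f)
      have a6 := hT false false k (node i f)
      have a7 := hT true true k (node i f)
      have a8 := hT true false k (node i f)
      generalize |m * (urnWt (hardCounts m false true) k -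
        urnWt (hardCounts m false false) k) +
        (urnWt (hardCounts m true true) k - urnWt (hardCounts m true false) k)| = dd at *
      generalize hell (urnWt (hardCounts m false true) k) (urnWt (hardCounts m false false) k) = HX
      generalize hell (urnWt (hardCounts m true true) k) (urnWt (hardCounts m true false) k) = HY
      generalize urnWt (hardCounts m false true) k = x1 at *
      generalize urnWt (hardCounts m false false) k = x2 at *
      generalize urnWt (hardCounts m true true) k = y1 at *
      generalize urnWt (hardCounts m true false) k = y2 at *
      generalize urnAvg (hardCounts m false true) k (node i f).touches = t1 at *
      generalize urnAvg (hardCounts m false false) k (node i f).touches = t2 at *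
      generalize urnAvg (hardCounts m true true) k (node i f).touches = t3 at *
      generalize urnAvg (hardCounts m true false) k (node i f).touches = t4 at *
      have e1 : (m : ℝ) * ((m : ℝ) ^ 3 / 2 * HX + (x1 + x2) / (m : ℝ) ^ 3 +
          4 / (m : ℝ) ^ 5 * ((m : ℝ) ^ 2 * (x1 + x2) + 2 * (t1 + t2))) =
          (m : ℝ) ^ 4 / 2 * HX + 5 * ((x1 + x2) / (m : ℝ) ^ 2) + 8 * ((t1 + t2) / (m : ℝ) ^ 4) := by
        field_simp; ring
      have e2 : (m : ℝ) ^ 2 / 2 * HY + (y1 + y2) / (m : ℝ) ^ 2 +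
          4 / (m : ℝ) ^ 4 * ((m : ℝ) ^ 2 * (y1 + y2) + 2 * (t3 + t4)) =
          (m : ℝ) ^ 2 / 2 * HY + 5 * ((y1 + y2) / (m : ℝ) ^ 2) + 8 * ((t3 + t4) / (m : ℝ) ^ 4) := by
        field_simp; ring
      have e3 : 1000 / (m : ℝ) ^ 4 * ((m : ℝ) ^ 2 * (y1 + y2 + (x1 + x2)) +
          2 * (t3 + t4 + (t1 + t2))) =
          1000 * ((x1 + x2) / (m : ℝ) ^ 2) + 1000 * ((y1 + y2) / (m : ℝ) ^ 2) +
          2000 * ((t1 + t2) / (m : ℝ) ^ 4) + 2000 * ((t3 + t4) / (m : ℝ) ^ 4) := by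
        field_simp; ring
      rw [e1, e2, e3]
      have b1 : 0 ≤ (x1 + x2) / (m : ℝ) ^ 2 := by positivity
      have b2 : 0 ≤ (y1 + y2) / (m : ℝ) ^ 2 := by positivity
      have b3 : 0 ≤ (t1 + t2) / (m : ℝ) ^ 4 := by positivity
      have b4 : 0 ≤ (t3 + t4) / (m : ℝ) ^ 4 := by positivity
      linarith
    · -- the first phase
      have hi := hA.1
      have htR : (known k : ℝ) ≤ (m : ℝ) ^ 2 := by exact_mod_cast ht
      have htB := known_le_of_le hm hβ htR
      set k' := fun s => Function.update k i (some s) with hk'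
      have hkn : ∀ s, known (k' s) = known k + 1 := fun s => known_update hi s
      have hstep : ∀ h v s, urnWt (hardCounts m h v) (k' s) * (8 * (m : ℝ) ^ 18 - known k) =
          (hardCounts m h v s - seen k s) * urnWt (hardCounts m h v) k := by
        intro h v s
        rw [← hβ]; exact urnWt_update_mul _ hi s
      have hseen : (seen k (some true) : ℝ) + seen k (some false) = known k := by
        have := sum_seen k
        rw [Fintype.sum_option, Fintype.sum_bool, hk, zero_add] at this
        exact_mod_cast this
      have hs1 : (0 : ℝ) ≤ seen k (some true) := Nat.cast_nonneg _
      have hs0 : (0 : ℝ) ≤ seen k (some false) := Nat.cast_nonneg _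
      have hseen' : ∀ b, (seen k (some b) : ℝ) ≤ (m : ℝ) ^ 2 := by
        intro b; cases b <;> linarith
      have hM2 : (m : ℝ) ^ 2 ≤ m ^ 18 := pow_le_pow_right₀ (by linarith) (by norm_num)
      have hM18 : 0 < (m : ℝ) ^ 18 := by positivity
      have hN7 : 7 * (m : ℝ) ^ 18 ≤ 8 * (m : ℝ) ^ 18 - known k := by linarith
      have hN0 : 0 < 8 * (m : ℝ) ^ 18 - known k := by linarith
      -- the invariants for the children
      have hchild : ∀ b, ∀ h v h' v', urnWt (hardCounts m h v) (k' (some b)) ≤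
          (1 + 16 / (m : ℝ) ^ 3) ^ known (k' (some b)) *
            urnWt (hardCounts m h' v') (k' (some b)) := by
        intro b h v h' v'
        refine le_of_mul_le_mul_right ?_ hN0
        rw [hkn, mul_assoc, hstep, hstep, pow_succ]
        have h1 := hardCounts_lower hm h v b
        have h2 := hardCounts_lower hm h' v' b
        have h3 := hardCounts_sub_le hm h v h' v' b
        have h4 := hseen' b
        have h5 : hardCounts m h v (some b) - seen k (some b) ≤
            (1 + 16 / (m : ℝ) ^ 3) * (hardCounts m h' v' (some b) - seen k (some b)) := by
          have h6 : 16 / (m : ℝ) ^ 3 * (3 * (m : ℝ) ^ 18) ≤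
              16 / (m : ℝ) ^ 3 * (hardCounts m h' v' (some b) - seen k (some b)) := by
            gcongr; linarith
          have h7 : 16 / (m : ℝ) ^ 3 * (3 * (m : ℝ) ^ 18) = 48 * (m : ℝ) ^ 15 := by
            field_simp; ring
          linarith
        calc (hardCounts m h v (some b) - seen k (some b)) * urnWt (hardCounts m h v) k
            ≤ ((1 + 16 / (m : ℝ) ^ 3) * (hardCounts m h' v' (some b) - seen k (some b))) *
              ((1 + 16 / (m : ℝ) ^ 3) ^ known k * urnWt (hardCounts m h' v') k) := by
              have h8 : 0 ≤ hardCounts m h v (some b) - seen k (some b) := by linarith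
              exact mul_le_mul h5 (hw h v h' v') (hwt _ _ _) (h8.trans h5)
          _ = _ := by ring
      have hih : ∀ b, _ := fun b => ih (some b) (k' (some b)) (hA.2 _)
        (by rw [hk', seen_update hi, hk]; simp) (by rw [hkn]; exact htl) (hchild b)
      have hih1 := hih true
      have hih0 := hih false
      -- A hard symbol ends the first phase. Only inputs with hard blocks reach this child, with
      -- conditional probability at most `5 / m ^ 3`, so its fixed loss contributes only `O(1 / m ^
      -- 5)`.
      have hYn := abs_sub_le_of_hard hm hβ (f none) (k' none) (hA.2 _)
      -- without hard blocks the child for a hard symbol is not reached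
      have hXw : ∀ v, urnWt (hardCounts m false v) (k' none) = 0 := by
        intro v
        have := hstep false v none
        rw [hk] at this
        simp only [hardCounts, Bool.false_eq_true, if_false, Nat.cast_zero, sub_zero, zero_mul,
          mul_eq_zero] at this
        exact this.resolve_right hN0.ne'
      have hXn : ∀ v, urnAvg (hardCounts m false v) (k' none) (f none).out = 0 := by
        intro v
        have := abs_urnAvg_le (hardCounts m false v) (k' none) ((f none).abs_out_le _ (hA.2 none))
        rw [hXw] at this
        exact abs_eq_zero.1 (le_antisymm this (abs_nonneg _))
      have hYw : ∀ v, urnWt (hardCounts m true v) (k' none) ≤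
          5 / (m : ℝ) ^ 3 * urnWt (hardCounts m true v) k := by
        intro v
        refine le_of_mul_le_mul_right ?_ hN0
        rw [hstep, hk]
        simp only [hardCounts, if_true, Nat.cast_zero, sub_zero]
        calc 32 * (m : ℝ) ^ 15 * urnWt (hardCounts m true v) k
            ≤ 35 * (m : ℝ) ^ 15 * urnWt (hardCounts m true v) k := by
              gcongr
              · exact hwt _ _ _
              · norm_num
          _ = 5 / (m : ℝ) ^ 3 * urnWt (hardCounts m true v) k * (7 * (m : ℝ) ^ 18) := by
              field_simp; ring
          _ ≤ _ := by
              have := hwt true v k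
              gcongr
      have hpow := one_add_pow_le hm htR
      have hw' : ∀ h v h' v', urnWt (hardCounts m h v) k - urnWt (hardCounts m h' v') k ≤
          32 / m * urnWt (hardCounts m h' v') k := by
        intro h v h' v'
        have := (hw h v h' v').trans (mul_le_mul_of_nonneg_right hpow (hwt h' v' k))
        linarith
      have hsx : ∀ h v, urnWt (hardCounts m h v) k = urnWt (hardCounts m h v) (k' none) +
          (urnWt (hardCounts m h v) (k' (some true)) +
            urnWt (hardCounts m h v) (k' (some false))) := by
        intro h v
        have := urnAvg_split (hardCounts m h v) hi (fun _ => (1 : ℝ))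
        rwa [Fintype.sum_option, Fintype.sum_bool] at this
      have hhX := sum_hell_update_le hi (hardCounts_none m false true false)
        (abs_hardCounts_sub_false m) (hardCounts_ge_card hm hβ false true)
        (hardCounts_ge_card hm hβ false false) htB
      have hhY := sum_hell_update_le hi (hardCounts_none m true true false)
        (abs_hardCounts_sub_true m) (hardCounts_ge_card hm hβ true true)
        (hardCounts_ge_card hm hβ true false) htB
      rw [Fintype.sum_option, Fintype.sum_bool] at hhX hhY
      simp only [urnAvg_out_node _ hi, urnAvg_touches_node _ hi]
      simp only [Fintype.sum_option, Fintype.sum_bool] at hih1 hih0 ⊢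
      change hell (urnWt _ (k' none)) (urnWt _ (k' none)) + (hell (urnWt _ (k' _)) (urnWt _ (k' _))
        + hell (urnWt _ (k' _)) (urnWt _ (k' _))) ≤ _ at hhX hhY
      have hD := abs_signed_step_le (W := urnWt (hardCounts m false true) k +
          urnWt (hardCounts m false false) k + urnWt (hardCounts m true true) k +
          urnWt (hardCounts m true false) k) hm hs1 hs0 (by linarith) (by rw [hseen])
        (hstep false true (some true)) (hstep false false (some true))
        (hstep true true (some true)) (hstep true false (some true))
        (hstep false true (some false)) (hstep false false (some false))
        (hstep true true (some false)) (hstep true false (some false))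
        (by
          have h1 := hw' false true true true
          have h2 := hw' false false true false
          have h3 := hw' true true false true
          have h4 := hw' true false false false
          have g1 := mul_nonneg (by positivity : 0 ≤ 32 / (m : ℝ)) (hwt false true k)
          have g2 := mul_nonneg (by positivity : 0 ≤ 32 / (m : ℝ)) (hwt false false k)
          have g3 := mul_nonneg (by positivity : 0 ≤ 32 / (m : ℝ)) (hwt true true k)
          have g4 := mul_nonneg (by positivity : 0 ≤ 32 / (m : ℝ)) (hwt true false k)
          rw [abs_le]; constructor <;> linarith)
        (by
          have h1 := hw' true true true false
          have h2 := hw' true false true true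
          have g1 := mul_nonneg (by positivity : 0 ≤ 32 / (m : ℝ)) (hwt false true k)
          have g2 := mul_nonneg (by positivity : 0 ≤ 32 / (m : ℝ)) (hwt false false k)
          have g3 := mul_nonneg (by positivity : 0 ≤ 32 / (m : ℝ)) (hwt true true k)
          have g4 := mul_nonneg (by positivity : 0 ≤ 32 / (m : ℝ)) (hwt true false k)
          rw [abs_le]; constructor <;> linarith)
      have hX1 := mul_le_mul_of_nonneg_left hhX (by positivity : 0 ≤ (m : ℝ) ^ 4 / 2)
      have hY1 := mul_le_mul_of_nonneg_left hhY (by positivity : 0 ≤ (m : ℝ) ^ 2 / 2)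
      have hhn := hell_nonneg (hwt false true (k' none)) (hwt false false (k' none))
      have hX2 : (m : ℝ) ^ 4 / 2 * (hell (urnWt (hardCounts m false true) (k' (some true)))
            (urnWt (hardCounts m false false) (k' (some true))) +
          hell (urnWt (hardCounts m false true) (k' (some false)))
            (urnWt (hardCounts m false false) (k' (some false)))) ≤
          (m : ℝ) ^ 4 / 2 *
            hell (urnWt (hardCounts m false true) k) (urnWt (hardCounts m false false) k) +
          4 * ((urnWt (hardCounts m false true) k + urnWt (hardCounts m false false) k) /
            (m : ℝ) ^ 4) := by
        refine le_trans ?_ (hX1.trans (le_of_eq ?_))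
        · exact mul_le_mul_of_nonneg_left (by linarith) (by positivity)
        · rw [hβ]; field_simp; ring
      have hY2 : (m : ℝ) ^ 2 / 2 * (hell (urnWt (hardCounts m true true) (k' none))
            (urnWt (hardCounts m true false) (k' none)) +
          (hell (urnWt (hardCounts m true true) (k' (some true)))
            (urnWt (hardCounts m true false) (k' (some true))) +
          hell (urnWt (hardCounts m true true) (k' (some false)))
            (urnWt (hardCounts m true false) (k' (some false))))) ≤
          (m : ℝ) ^ 2 / 2 *
            hell (urnWt (hardCounts m true true) k) (urnWt (hardCounts m true false) k) +
          4 * ((urnWt (hardCounts m true true) k + urnWt (hardCounts m true false) k) /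
            (m : ℝ) ^ 4) := by
        refine hY1.trans (le_of_eq ?_)
        rw [hβ]; field_simp; ring
      have hY3 : (urnWt (hardCounts m true true) (k' none) +
          urnWt (hardCounts m true false) (k' none)) / (m : ℝ) ^ 2 ≤
          5 * ((urnWt (hardCounts m true true) k + urnWt (hardCounts m true false) k) /
            (m : ℝ) ^ 4) := by
        have h1 := hYw true
        have h2 := hYw false
        have g1 := hwt true true k
        have g2 := hwt true false k
        calc _ ≤ (5 / (m : ℝ) ^ 3 * (urnWt (hardCounts m true true) k +
              urnWt (hardCounts m true false) k)) / (m : ℝ) ^ 2 := by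
              gcongr; linarith
          _ = 5 * ((urnWt (hardCounts m true true) k + urnWt (hardCounts m true false) k) /
            (m : ℝ) ^ 5) := by field_simp
          _ ≤ _ := by
            gcongr
            · linarith
            · norm_num
      have hcast : ∀ s, (known (k' s) : ℝ) = known k + 1 := by
        intro s; rw [hkn]; push_cast; ring
      rw [hcast] at hih1 hih0 hYn
      rw [hXn, hXn, zero_add, zero_add]
      have habs : ∀ M x y x' y' n p q p' q' : ℝ,
          |M * (x + x' - (y + y')) + (n + (p + p') - (0 + (q + q')))| ≤
          |n| + |M * (x - y) + (p - q)| + |M * (x' - y') + (p' - q')| := by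
        intro M x y x' y' n p q p' q'
        refine le_trans (le_of_eq ?_) (abs_add_three _ _ _)
        congr 1; ring
      refine le_trans (le_trans (le_of_eq ?_) (habs m _ _ _ _ (_ - _) _ _ _ _))
        (le_trans (add_le_add (add_le_add hYn hih1) hih0) ?_)
      · congr 1; ring
      have ex1 := hsx false true
      have ex2 := hsx false false
      have ey1 := hsx true true
      have ey2 := hsx true false
      rw [hXw, zero_add] at ex1 ex2
      have n1 := hwt false true (k' (some true))
      have n2 := hwt false true (k' (some false))
      have n3 := hwt false false (k' (some true))
      have n4 := hwt false false (k' (some false))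
      have n5 := hwt true true (k' (some true))
      have n6 := hwt true true (k' (some false))
      have n7 := hwt true false (k' (some true))
      have n8 := hwt true false (k' (some false))
      have n9 := hwt true true (k' none)
      have n10 := hwt true false (k' none)
      have u1 := hT false true (k' none) (f none)
      have u2 := hT false false (k' none) (f none)
      have u3 := hT true true (k' none) (f none)
      have u4 := hT true false (k' none) (f none)
      have ht0 : (0 : ℝ) ≤ known k := Nat.cast_nonneg _
      clear hih hw' hXn hXw hYw hhX hhY hX1 hY1 hhn hih1 hih0 hYn hchild hstep hseen' habs ih hw
        hsx hwt hT hcast hpow hkn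
      -- In units of `1 / m ^ 4` times weight, the draw pays 2000. At most 1000 goes into the rise
      -- of `known`; the rest covers 220 from the signed step, the Hellinger growth and the hard
      -- child.
      have hq : ∀ r : ℝ, r / (m : ℝ) ^ 4 = r * (1 / (m : ℝ) ^ 4) := fun r => by ring
      have hq0 : 0 ≤ 1 / (m : ℝ) ^ 4 := by positivity
      rw [hq] at hX2 hY2 hY3 hD
      rw [hq 1000, hq 4]
      generalize 1 / (m : ℝ) ^ 4 = q at *
      generalize |m * (urnWt (hardCounts m false true) k -
        urnWt (hardCounts m false false) k) +
        (urnWt (hardCounts m true true) k - urnWt (hardCounts m true false) k)| = dd at *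
      generalize hell (urnWt (hardCounts m false true) k) (urnWt (hardCounts m false false) k) = HX
        at *
      generalize hell (urnWt (hardCounts m true true) k) (urnWt (hardCounts m true false) k) = HY
        at *
      rw [ex1, ex2] at hX2
      rw [ey1, ey2] at hY2 hY3
      rw [ex1, ex2, ey1, ey2] at hD ⊢
      have v1 := mul_nonneg hq0 n1
      have v2 := mul_nonneg hq0 n2
      have v3 := mul_nonneg hq0 n3
      have v4 := mul_nonneg hq0 n4
      have v5 := mul_nonneg hq0 n5
      have v6 := mul_nonneg hq0 n6
      have v7 := mul_nonneg hq0 n7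
      have v8 := mul_nonneg hq0 n8
      have v9 := mul_nonneg hq0 n9
      have v10 := mul_nonneg hq0 n10
      have v11 := mul_nonneg (mul_nonneg hq0 ht0) n9
      have v12 := mul_nonneg (mul_nonneg hq0 ht0) n10
      have z1 := mul_nonneg hq0 u1
      have z2 := mul_nonneg hq0 u2
      have z3 := mul_nonneg hq0 u3
      have z4 := mul_nonneg hq0 u4
      linarith

end BlockProc

end Urn

/-! ### Hits of disjoint sets by a decision tree -/

/-- The sign of a bit. -/
noncomputable def bitSign (b : Bool) : ℝ := if b then 1 else -1

lemma abs_bitSign (b : Bool) : |bitSign b| = 1 := by cases b <;> simp [bitSign]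

/-- The indicator of the event that a tree queries a bit in `S`. -/
def DecTree.hits {ι : Type} (S : ι → Prop) [DecidablePred S] : DecTree ι → (ι → Bool) → ℕ
  | .leaf _, _ => 0
  | .query i t₀ t₁, x => if S i then 1 else if x i then t₁.hits S x else t₀.hits S x

/-- Every query lies in at most one of the disjoint sets, so no more sets are hit than queries are
made. -/
lemma DecTree.sum_hits_le {ι κ : Type} (P : Finset κ) (S : κ → ι → Prop)
    [∀ p, DecidablePred (S p)] (hS : ∀ p q i, S p i → S q i → p = q) (D : DecTree ι)
    (x : ι → Bool) : ∑ p ∈ P, D.hits (S p) x ≤ D.cost x := by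
  induction D with
  | leaf b => simp [DecTree.hits]
  | query i t₀ t₁ h₀ h₁ =>
    have h1 : ∑ p ∈ P, (if S p i then 1 else 0) ≤ 1 := by
      rw [← Finset.card_filter, Finset.card_le_one]
      intro a ha b hb
      exact hS a b i (Finset.mem_filter.1 ha).2 (Finset.mem_filter.1 hb).2
    have h2 : ∀ t : DecTree ι, ∑ p ∈ P, (if S p i then 1 else t.hits (S p) x) ≤
        ∑ p ∈ P, (if S p i then 1 else 0) + ∑ p ∈ P, t.hits (S p) x := by
      intro t
      rw [← Finset.sum_add_distrib]
      refine Finset.sum_le_sum fun p _ => ?_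
      split_ifs <;> omega
    simp only [DecTree.hits, DecTree.cost]
    split_ifs with hx
    · have := h2 t₁; omega
    · have := h2 t₀; omega

lemma DecTree.hits_eq_zero {ι : Type} (S : ι → Prop) [DecidablePred S] (hS : ∀ i, ¬ S i)
    (D : DecTree ι) (x : ι → Bool) : D.hits S x = 0 := by
  induction D with
  | leaf b => rfl
  | query i t₀ t₁ h₀ h₁ => simp [DecTree.hits, hS, h₀, h₁]

/-! ### From decision trees to block procedures: the hidden position of hard blocks -/

section Inputs

variable {β : Type} {n : ℕ}

/-- The bit `q` in a block with the symbol `s`, where `w` provides the bits that the symbol leaves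
open. -/
def symBit (s : Option Bool) (w : β × Fin n → Bool) (q : β × Fin n) : Bool :=
  match s with
  | none => if q.2.val = 0 then true else w q
  | some b => if q.2.val = 0 then false else if q.2.val = 1 then b else w q

/-- The input with the symbols `z` and the free bits `w`. -/
def decode (z : β → Option Bool) (w : β × Fin n → Bool) : β × Fin n → Bool :=
  fun q => symBit (z q.1) w q

/-- If `v` is `true`, flip the bit at the position `p` in all hard blocks. -/
def flipHard (v : Bool) (p : Fin n) (z : β → Option Bool) (w : β × Fin n → Bool) :
    β × Fin n → Bool :=
  fun q => xor (w q) (v && (decide (q.2 = p) && (z q.1).isNone))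

/-- The bit `q` is the one at the position `p` of a hard block. -/
def IsKey (p : Fin n) (z : β → Option Bool) (q : β × Fin n) : Prop := z q.1 = none ∧ q.2 = p

instance (p : Fin n) (z : β → Option Bool) : DecidablePred (IsKey (n := n) p z) :=
  fun _ => inferInstanceAs (Decidable (_ ∧ _))

/-- The right side does not involve `v`: only the bits at the position `p` of hard blocks carry the
flip. -/
lemma decode_flipHard {v : Bool} {p : Fin n} {z : β → Option Bool} {w : β × Fin n → Bool}
    {q : β × Fin n} (h : ¬ IsKey p z q) : decode z (flipHard v p z w) q = symBit (z q.1) w q := by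
  have : flipHard v p z w q = w q := by
    unfold flipHard
    have h2 : (decide (q.2 = p) && (z q.1).isNone) = false := by
      rw [Bool.eq_false_iff]
      intro h3
      rw [Bool.and_eq_true, decide_eq_true_eq, Option.isNone_iff_eq_none] at h3
      exact h ⟨h3.2, h3.1⟩
    rw [h2]; simp
  unfold decode symBit
  rw [this]

/-- A decision tree on block inputs, seen as a procedure that reveals symbols, for fixed free bits
`u`. It stops when the position `p` of a hard block is queried. -/
noncomputable def DecTree.toProc [DecidableEq β] (p : Fin n) (u : β × Fin n → Bool) :
    DecTree (β × Fin n) → (β → Option (Option Bool)) → BlockProc β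
  | .leaf b, _ => .leaf (bitSign b)
  | .query q t₀ t₁, k =>
    match k q.1 with
    | some s => if s = none ∧ q.2 = p then .leaf 0 else
        if symBit s u q then t₁.toProc p u k else t₀.toProc p u k
    | none => .node q.1 fun s => if s = none ∧ q.2 = p then .leaf 0 else
        if symBit s u q then t₁.toProc p u (Function.update k q.1 (some s))
        else t₀.toProc p u (Function.update k q.1 (some s))

variable [DecidableEq β]

lemma DecTree.toProc_fresh (p : Fin n) (u : β × Fin n → Bool) (D : DecTree (β × Fin n))
    (k : β → Option (Option Bool)) : (D.toProc p u k).Fresh k := by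
  induction D generalizing k with
  | leaf b => simp only [DecTree.toProc, BlockProc.Fresh]; rw [abs_bitSign]
  | query q t₀ t₁ h₀ h₁ =>
    rw [DecTree.toProc]
    rcases hk : k q.1 with _ | s <;> dsimp only
    · refine ⟨hk, fun s => ?_⟩
      dsimp only
      split_ifs
      · simp [BlockProc.Fresh]
      · exact h₁ _
      · exact h₀ _
    · split_ifs
      · simp [BlockProc.Fresh]
      · exact h₁ k
      · exact h₀ k

/-- Before a key is queried, the procedure and the tree see the same bits. At a key the procedure
outputs 0, which is at distance 1 from either sign. -/
lemma DecTree.abs_toProc_out_sub_le [Fintype β] (v : Bool) (p : Fin n) (u : β × Fin n → Bool)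
    (D : DecTree (β × Fin n)) (k : β → Option (Option Bool)) (z : β → Option Bool)
    (hz : Extends k z) :
    |bitSign (D.eval (decode z (flipHard v p z u))) - (D.toProc p u k).out z| ≤
      D.hits (IsKey p z) (decode z (flipHard v p z u)) := by
  induction D generalizing k with
  | leaf b => simp [DecTree.toProc, BlockProc.out, DecTree.eval, DecTree.hits]
  | query q t₀ t₁ h₀ h₁ =>
    by_cases hkey : IsKey p z q
    · have hkey' : z q.1 = none ∧ q.2 = p := hkey
      have hout : (DecTree.toProc p u (.query q t₀ t₁) k).out z = 0 := by
        rw [DecTree.toProc]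
        rcases hk : k q.1 with _ | s <;> dsimp only
        · rw [BlockProc.out, if_pos hkey']; rfl
        · rw [← hz _ _ hk, if_pos hkey']; rfl
      rw [hout, sub_zero, abs_bitSign]
      simp [DecTree.hits, hkey]
    · have hkey' : ¬ (z q.1 = none ∧ q.2 = p) := hkey
      have hbit := decode_flipHard (v := v) (w := u) hkey
      simp only [DecTree.eval, DecTree.hits, hkey, if_false, hbit]
      rw [DecTree.toProc]
      rcases hk : k q.1 with _ | s <;> dsimp only
      · rw [BlockProc.out, if_neg hkey']
        split_ifs
        · exact h₁ _ ((extends_update hk _ z).2 ⟨hz, rfl⟩)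
        · exact h₀ _ ((extends_update hk _ z).2 ⟨hz, rfl⟩)
      · rw [← hz _ _ hk, if_neg hkey']
        split_ifs
        · exact h₁ k hz
        · exact h₀ k hz

lemma DecTree.toProc_touches_le [Fintype β] (v : Bool) (p : Fin n) (u : β × Fin n → Bool)
    (D : DecTree (β × Fin n)) (k : β → Option (Option Bool)) (z : β → Option Bool)
    (hz : Extends k z) :
    (D.toProc p u k).touches z ≤ D.cost (decode z (flipHard v p z u)) := by
  induction D generalizing k with
  | leaf b => simp [DecTree.toProc, BlockProc.touches, DecTree.cost]
  | query q t₀ t₁ h₀ h₁ =>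
    by_cases hkey : IsKey p z q
    · have hkey' : z q.1 = none ∧ q.2 = p := hkey
      have hout : (DecTree.toProc p u (.query q t₀ t₁) k).touches z ≤ 1 := by
        rw [DecTree.toProc]
        rcases hk : k q.1 with _ | s <;> dsimp only
        · rw [BlockProc.touches, if_pos hkey']; simp [BlockProc.touches]
        · rw [← hz _ _ hk, if_pos hkey']; simp [BlockProc.touches]
      refine hout.trans ?_
      simp only [DecTree.cost, Nat.cast_add, Nat.cast_one]
      linarith [Nat.cast_nonneg (α := ℝ) (if decode z (flipHard v p z u) q = true then
        t₁.cost (decode z (flipHard v p z u)) else t₀.cost (decode z (flipHard v p z u)))]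
    · have hkey' : ¬ (z q.1 = none ∧ q.2 = p) := hkey
      have hbit := decode_flipHard (v := v) (w := u) hkey
      simp only [DecTree.cost, hbit]
      rw [DecTree.toProc]
      push_cast
      rcases hk : k q.1 with _ | s <;> dsimp only
      · rw [BlockProc.touches, if_neg hkey']
        split_ifs
        · linarith [h₁ _ ((extends_update hk (z q.1) z).2 ⟨hz, rfl⟩)]
        · linarith [h₀ _ ((extends_update hk (z q.1) z).2 ⟨hz, rfl⟩)]
      · rw [← hz _ _ hk, if_neg hkey']
        split_ifs
        · linarith [h₁ k hz]
        · linarith [h₀ k hz]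

/-- The parity of the bits of block `i` at positive positions. -/
def OddBlock (w : β × Fin n → Bool) (i : β) : Prop :=
  Odd (Finset.univ.filter fun j : Fin n => 0 < j.val ∧ w (i, j) = true).card

lemma odd_card_update {w w' : Fin n → Bool} {p : Fin n} (hp : p.val ≠ 0)
    (h : ∀ j, j ≠ p → w' j = w j) (hwp : w' p = !w p) :
    Odd (Finset.univ.filter fun j : Fin n => 0 < j.val ∧ w' j = true).card ↔
      ¬ Odd (Finset.univ.filter fun j : Fin n => 0 < j.val ∧ w j = true).card := by
  have key : ∀ w w' : Fin n → Bool, (∀ j, j ≠ p → w' j = w j) → w p = false → w' p = true →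
      (Finset.univ.filter fun j : Fin n => 0 < j.val ∧ w' j = true).card =
      (Finset.univ.filter fun j : Fin n => 0 < j.val ∧ w j = true).card + 1 := by
    intro w w' h h0 h1
    rw [← Finset.card_insert_of_notMem (a := p) (by simp [h0])]
    congr 1
    ext j
    by_cases hj : j = p
    · subst hj; simp [h1, Nat.pos_of_ne_zero hp]
    · simp [hj, h j hj]
  cases hw : w p
  · rw [key w w' h hw (by simp [hwp, hw]), Nat.odd_add_one]
  · rw [key w' w (fun j hj => (h j hj).symm) (by simp [hwp, hw]) hw, Nat.odd_add_one, not_not]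

lemma oddBlock_flipHard {v : Bool} {p : Fin n} (hp : p.val ≠ 0) (z : β → Option Bool)
    (w : β × Fin n → Bool) (i : β) :
    OddBlock (flipHard v p z w) i ↔ (if v = true ∧ z i = none then ¬ OddBlock w i else OddBlock w i) := by
  unfold OddBlock
  split_ifs with h
  · refine odd_card_update (w := fun j => w (i, j)) (w' := fun j => flipHard v p z w (i, j)) hp ?_ ?_
    · intro j hj; simp [flipHard, hj]
    · simp [flipHard, h.1, h.2]
  · have : ∀ j, flipHard v p z w (i, j) = w (i, j) := by
      intro j
      cases v
      · simp [flipHard]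
      · have : (z i).isNone = false := by
          rw [Bool.eq_false_iff]; intro h2; exact h ⟨rfl, Option.isNone_iff_eq_none.1 h2⟩
        simp [flipHard, this]
    simp only [this]

lemma flipHard_flipHard (v : Bool) (p : Fin n) (z : β → Option Bool) (w : β × Fin n → Bool) :
    flipHard v p z (flipHard v p z w) = w := by
  funext q
  simp [flipHard]

open Classical in
/-- The choices of free bits with all parities even. -/
noncomputable def evenBits (β : Type) [Fintype β] [DecidableEq β] (n : ℕ) :
    Finset (β × Fin n → Bool) :=
  Finset.univ.filter fun w => ∀ i, ¬ OddBlock w i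

lemma mem_evenBits [Fintype β] {w : β × Fin n → Bool} :
    w ∈ evenBits β n ↔ ∀ i, ¬ OddBlock w i := by
  simp [evenBits]

open Classical in
/-- The choices of free bits whose parity is odd exactly in the hard blocks (if `v` is `true`) or
nowhere (if `v` is `false`). -/
noncomputable def parityBits [Fintype β] (v : Bool) (z : β → Option Bool) :
    Finset (β × Fin n → Bool) :=
  Finset.univ.filter fun w => ∀ i, OddBlock w i ↔ (v = true ∧ z i = none)

/-- The distribution of the input does not depend on the position that is flipped. -/
lemma sum_flipHard [Fintype β] (v : Bool) {p : Fin n} (hp : p.val ≠ 0) (z : β → Option Bool)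
    (F : (β × Fin n → Bool) → ℝ) :
    ∑ u ∈ evenBits β n, F (flipHard v p z u) = ∑ w ∈ parityBits v z, F w := by
  refine Finset.sum_bij' (fun u _ => flipHard v p z u) (fun w _ => flipHard v p z w) ?_ ?_ ?_ ?_ ?_
  · intro u hu
    simp only [evenBits, parityBits, Finset.mem_filter, Finset.mem_univ, true_and] at hu ⊢
    intro i
    rw [oddBlock_flipHard hp]
    split_ifs with h
    · exact ⟨fun _ => h, fun _ => hu i⟩
    · exact ⟨fun h' => absurd h' (hu i), fun h' => absurd h' h⟩
  · intro w hw
    simp only [evenBits, parityBits, Finset.mem_filter, Finset.mem_univ, true_and] at hw ⊢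
    intro i
    rw [oddBlock_flipHard hp]
    split_ifs with h
    · exact fun h' => h' ((hw i).2 h)
    · exact fun h' => h ((hw i).1 h')
  · intro u _; exact flipHard_flipHard _ _ _ _
  · intro u _; exact flipHard_flipHard _ _ _ _
  · intro u _; rfl

lemma evenBits_nonempty [Fintype β] : (evenBits β n).Nonempty :=
  ⟨fun _ => false, by simp [evenBits, OddBlock]⟩

/-- The positions that may be flipped. -/
def keyPositions (n : ℕ) : Finset (Fin n) := Finset.univ.filter fun p => p.val ≠ 0

lemma card_keyPositions (hn : 0 < n) : (keyPositions n).card = n - 1 := by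
  obtain ⟨l, rfl⟩ : ∃ l, n = l + 1 := ⟨n - 1, by omega⟩
  have : keyPositions (l + 1) = Finset.univ.erase 0 := by
    ext p
    simp only [keyPositions, Finset.mem_filter, Finset.mem_univ, true_and, Finset.mem_erase,
      and_true, ne_eq, Fin.ext_iff, Fin.val_zero]
  rw [this, Finset.card_erase_of_mem (Finset.mem_univ _)]; simp

/-- A tree rarely queries the flipped position of a hard block. -/
lemma sum_hits_le_sum_cost [Fintype β] (v : Bool) (z : β → Option Bool)
    (D : DecTree (β × Fin n)) (hn : 0 < n) :
    ((n : ℝ) - 1) * ∑ p ∈ keyPositions n, ∑ u ∈ evenBits β n,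
        (D.hits (IsKey p z) (decode z (flipHard v p z u)) : ℝ) ≤
      ∑ p ∈ keyPositions n, ∑ u ∈ evenBits β n, (D.cost (decode z (flipHard v p z u)) : ℝ) := by
  -- After the change of variables the input `w` no longer depends on `p`. On a fixed run, the keys
  -- for different `p` are disjoint, so all `n - 1` choices together are hit at most as often as
  -- there are queries.
  have h1 : ∀ p ∈ keyPositions n, ∑ u ∈ evenBits β n,
      (D.hits (IsKey p z) (decode z (flipHard v p z u)) : ℝ) =
      ∑ w ∈ parityBits v z, (D.hits (IsKey p z) (decode z w) : ℝ) := fun p hp =>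
    sum_flipHard v (Finset.mem_filter.1 hp).2 z fun w => (D.hits (IsKey p z) (decode z w) : ℝ)
  have h2 : ∀ p ∈ keyPositions n, ∑ u ∈ evenBits β n,
      (D.cost (decode z (flipHard v p z u)) : ℝ) =
      ∑ w ∈ parityBits v z, (D.cost (decode z w) : ℝ) := fun p hp =>
    sum_flipHard v (Finset.mem_filter.1 hp).2 z fun w => (D.cost (decode z w) : ℝ)
  rw [Finset.sum_congr rfl h1, Finset.sum_congr rfl h2, Finset.sum_const, card_keyPositions hn,
    nsmul_eq_mul, Nat.cast_sub hn, Nat.cast_one, Finset.sum_comm]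
  have h3 : (0 : ℝ) ≤ n - 1 := by
    have : (1 : ℝ) ≤ n := by exact_mod_cast hn
    linarith
  refine mul_le_mul_of_nonneg_left (Finset.sum_le_sum fun w _ => ?_) h3
  exact_mod_cast D.sum_hits_le _ (fun p => IsKey p z) (fun p q i hp hq => hp.2.symm.trans hq.2) _

end Inputs

/-! ### The hard inputs satisfy the promise -/

lemma urn_nonempty {β : Type} [Fintype β] [DecidableEq β] {c : Option Bool → ℝ} {a b d : ℕ}
    (ha : c none = a) (hb : c (some true) = b) (hd : c (some false) = d)
    (h : a + b + d = Fintype.card β) : (urn (β := β) c).Nonempty := by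
  classical
  obtain ⟨S, hS, hSa⟩ := Finset.exists_subset_card_eq (s := (Finset.univ : Finset β)) (n := a)
    (by rw [Finset.card_univ]; omega)
  obtain ⟨T, hT, hTb⟩ := Finset.exists_subset_card_eq (s := Sᶜ) (n := b)
    (by rw [Finset.card_compl]; omega)
  have hTS : ∀ i, i ∈ T → i ∉ S := fun i hi => Finset.mem_compl.1 (hT hi)
  refine ⟨fun i => if i ∈ S then none else if i ∈ T then some true else some false, ?_⟩
  simp only [urn, Finset.mem_filter, Finset.mem_univ, true_and]
  rintro (_ | _ | _)
  · rw [ha, Nat.cast_inj, ← hSa]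
    congr 1
    ext i
    by_cases h1 : i ∈ S <;> by_cases h2 : i ∈ T <;> simp [h1, h2]
  · rw [hd, Nat.cast_inj]
    have : (Finset.univ.filter fun i : β => (if i ∈ S then none else if i ∈ T then some true
        else some false) = some false) = (S ∪ T)ᶜ := by
      ext i
      by_cases h1 : i ∈ S <;> by_cases h2 : i ∈ T <;> simp [h1, h2]
    rw [this, Finset.card_compl, Finset.card_union_of_disjoint, hSa, hTb]
    · omega
    · exact Finset.disjoint_right.2 hTS
  · rw [hb, Nat.cast_inj, ← hTb]
    congr 1
    ext i
    have := hTS i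
    by_cases h1 : i ∈ S <;> by_cases h2 : i ∈ T <;> simp_all

lemma urn_hardCounts_nonempty {β : Type} [Fintype β] [DecidableEq β] {m : ℕ} (hm : 1000 ≤ m)
    (hβ : Fintype.card β = 8 * m ^ 18) (h v : Bool) : (urn (β := β) (hardCounts m h v)).Nonempty := by
  have e1 : m ^ 18 = m ^ 15 * m ^ 3 := by ring
  have e2 : m ^ 15 = m ^ 14 * m := by ring
  have e3 : 1000 ≤ m ^ 3 := hm.trans (Nat.le_self_pow (by norm_num) m)
  have h1 : 24 * m ^ 15 ≤ 4 * m ^ 18 := by rw [e1]; nlinarith [Nat.zero_le (m ^ 15)]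
  have h2 : 8 * m ^ 14 ≤ 8 * m ^ 15 := by rw [e2]; nlinarith [Nat.zero_le (m ^ 14)]
  cases h <;> cases v
  · refine urn_nonempty (a := 0) (b := 4 * m ^ 18 - 8 * m ^ 14) (d := 4 * m ^ 18 + 8 * m ^ 14)
      ?_ ?_ ?_ (by omega)
    · simp [hardCounts]
    · rw [Nat.cast_sub (by omega)]; push_cast; simp [hardCounts]
    · push_cast; simp [hardCounts]
  · refine urn_nonempty (a := 0) (b := 4 * m ^ 18 + 8 * m ^ 14) (d := 4 * m ^ 18 - 8 * m ^ 14)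
      ?_ ?_ ?_ (by omega)
    · simp [hardCounts]
    · push_cast; simp [hardCounts]
    · rw [Nat.cast_sub (by omega)]; push_cast; simp [hardCounts]
  · refine urn_nonempty (a := 32 * m ^ 15) (b := 4 * m ^ 18 - 8 * m ^ 15)
      (d := 4 * m ^ 18 - 24 * m ^ 15) ?_ ?_ ?_ (by omega)
    · push_cast; simp [hardCounts]
    · rw [Nat.cast_sub (by omega)]; push_cast; simp [hardCounts]
    · rw [Nat.cast_sub (by omega)]; push_cast; simp [hardCounts]
  · refine urn_nonempty (a := 32 * m ^ 15) (b := 4 * m ^ 18 - 24 * m ^ 15)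
      (d := 4 * m ^ 18 - 8 * m ^ 15) ?_ ?_ ?_ (by omega)
    · push_cast; simp [hardCounts]
    · rw [Nat.cast_sub (by omega)]; push_cast; simp [hardCounts]
    · rw [Nat.cast_sub (by omega)]; push_cast; simp [hardCounts]

lemma numValue_add {n B : ℕ} (x : Fin B × Fin n → Bool) :
    numValue x true + numValue x false = B := by
  unfold numValue
  have := Finset.card_filter_add_card_filter_not (s := (Finset.univ : Finset (Fin B)))
    (fun i => blockValue (fun j => x (i, j)) = true)
  simpa using this

lemma SepPromise.half_lt {n B : ℕ} {bX bY : ℝ} {x : Fin B × Fin n → Bool} {v : Bool}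
    (hB : 0 < B) (hX : 0 < bX) (hY : 0 < bY) (h : SepPromise bX bY x v) :
    (B : ℝ) / 2 < numValue x v := by
  have hB' : (0 : ℝ) < B := by exact_mod_cast hB
  rcases h with h | h
  · have := mul_pos hB' hX; linarith [h.2]
  · have := mul_pos hB' hY; linarith [h.2]

lemma sepFun_eq_some {n B : ℕ} {bX bY : ℝ} {x : Fin B × Fin n → Bool} {v : Bool}
    (hB : 0 < B) (hX : 0 < bX) (hY : 0 < bY) (h : SepPromise bX bY x v) :
    sepFun n B bX bY x = some v := by
  unfold sepFun
  cases v
  · rw [if_neg, if_pos h]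
    intro h'
    have h1 := h.half_lt hB hX hY
    have h2 := h'.half_lt hB hX hY
    have h3 : ((numValue x true + numValue x false : ℕ) : ℝ) = B := by rw [numValue_add]
    push_cast at h3
    linarith
  · rw [if_pos h]

lemma promise_of_sepFun {n B : ℕ} {bX bY : ℝ} {x : Fin B × Fin n → Bool} {v : Bool}
    (h : sepFun n B bX bY x = some v) : SepPromise bX bY x v := by
  unfold sepFun at h
  split_ifs at h with h1 h2
  · simp only [Option.some.injEq] at h; rwa [← h]
  · simp only [Option.some.injEq] at h; rwa [← h]

lemma blockHard_decode {β : Type} {n : ℕ} (hn : 1 < n) (z : β → Option Bool)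
    (w : β × Fin n → Bool) (i : β) :
    blockHard (fun j => decode z w (i, j)) = (z i).isNone := by
  have : 0 < n := by omega
  unfold blockHard blockBit decode symBit
  rcases hz : z i with _ | b <;> simp [this, hz]

lemma blockValue_decode {β : Type} {n : ℕ} (hn : 1 < n) {v : Bool} {z : β → Option Bool}
    {w : β × Fin n → Bool} {i : β} (hw : z i = none → (OddBlock w i ↔ v = true)) :
    blockValue (fun j => decode z w (i, j)) = (z i).getD v := by
  unfold blockValue
  rw [blockHard_decode hn]
  rcases hz : z i with _ | b
  · simp only [Option.isNone_none, if_true, Option.getD_none]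
    have h1 : (Finset.univ.filter fun j : Fin n => 0 < j.val ∧ decode z w (i, j) = true) =
        Finset.univ.filter fun j : Fin n => 0 < j.val ∧ w (i, j) = true := by
      refine Finset.filter_congr fun j _ => and_congr_right fun hj => ?_
      unfold decode symBit
      simp [hz, hj.ne']
    rw [h1]
    have h2 := hw hz
    unfold OddBlock at h2
    rw [Bool.eq_iff_iff, decide_eq_true_iff]
    exact h2
  · simp [blockBit, hn, decode, symBit, hz]

/-- The majority condition is met with equality: `v` has `4 * m ^ 18 + 8 * m ^ 14` blocks without
hard blocks, and `32 * m ^ 15 + (4 * m ^ 18 - 24 * m ^ 15) = 4 * m ^ 18 + 8 * m ^ 15` with them. -/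
lemma sepFamily_decode {m : ℕ} (hm : 1000 ≤ m) {h v : Bool} {z : Fin (8 * m ^ 18) → Option Bool}
    (hz : z ∈ urn (hardCounts m h v)) {w : Fin (8 * m ^ 18) × Fin (m ^ 4) → Bool}
    (hw : ∀ i, z i = none → (OddBlock w i ↔ v = true)) :
    sepFamily m (decode z w) = some v := by
  classical
  have hm0 : (0 : ℝ) < m := by exact_mod_cast (by omega : 0 < m)
  have hn : 1 < m ^ 4 := Nat.one_lt_pow (by norm_num) (by omega)
  refine sepFun_eq_some (by positivity) (by positivity) (by positivity) ?_
  simp only [urn, Finset.mem_filter, Finset.mem_univ, true_and] at hz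
  have hH : (numHard (decode z w) : ℝ) = hardCounts m h v none := by
    rw [← hz none]
    unfold numHard
    congr 2
    ext i
    simp [blockHard_decode hn]
  have hV : (numValue (decode z w) v : ℝ) = hardCounts m h v none + hardCounts m h v (some v) := by
    rw [← hz none, ← hz (some v)]
    norm_cast
    unfold numValue
    rw [← Finset.card_union_of_disjoint]
    · congr 1
      ext i
      simp only [Finset.mem_union, Finset.mem_filter, Finset.mem_univ, true_and]
      rw [blockValue_decode hn (hw i)]
      rcases z i with _ | b <;> simp
    · rw [Finset.disjoint_left]
      intro i h1 h2
      simp only [Finset.mem_filter, Finset.mem_univ, true_and] at h1 h2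
      simp [h1] at h2
  unfold SepPromise
  rw [hH, hV]
  cases h
  · left
    constructor
    · have : (numHard (decode z w) : ℝ) = 0 := by rw [hH]; rfl
      exact_mod_cast this
    · simp only [hardCounts, Bool.false_eq_true, if_false, if_true]
      push_cast
      apply le_of_eq; field_simp; ring
  · right
    constructor
    · simp only [hardCounts, if_true]
      push_cast
      field_simp; ring
    · simp only [hardCounts, if_true]
      push_cast
      apply le_of_eq; field_simp; ring

/-! ### Advantage of decision trees on the hard distributions -/

section Average

variable {β : Type} [Fintype β] [DecidableEq β] {n : ℕ}

/-- The average of `F` over the hard distribution of inputs of value `v` without hard blocks (`h` is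
`false`) or with hard blocks (`h` is `true`). -/
noncomputable def hardAvg (m : ℕ) (h v : Bool) (F : (β × Fin n → Bool) → ℝ) : ℝ :=
  (∑ p ∈ keyPositions n, ∑ u ∈ evenBits β n,
    urnAvg (hardCounts m h v) (fun _ => none) fun z => F (decode z (flipHard v p z u))) /
    ((keyPositions n).card * (evenBits β n).card)

lemma hardAvg_mono (m : ℕ) (h v : Bool) {F G : (β × Fin n → Bool) → ℝ} (hFG : ∀ x, F x ≤ G x) :
    hardAvg m h v F ≤ hardAvg m h v G := by
  unfold hardAvg urnAvg
  gcongr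
  exact hFG _

lemma hardAvg_add (m : ℕ) (h v : Bool) (F G : (β × Fin n → Bool) → ℝ) :
    hardAvg m h v (fun x => F x + G x) = hardAvg m h v F + hardAvg m h v G := by
  unfold hardAvg
  simp only [urnAvg_add, Finset.sum_add_distrib, add_div]

lemma urnAvg_mul_left (c : Option Bool → ℝ) (k : β → Option (Option Bool)) (a : ℝ)
    (F : (β → Option Bool) → ℝ) : urnAvg c k (fun z => a * F z) = a * urnAvg c k F := by
  unfold urnAvg
  rw [← Finset.mul_sum, mul_div_assoc]

lemma hardAvg_mul_left (m : ℕ) (h v : Bool) (a : ℝ) (F : (β × Fin n → Bool) → ℝ) :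
    hardAvg m h v (fun x => a * F x) = a * hardAvg m h v F := by
  unfold hardAvg
  simp only [urnAvg_mul_left, ← Finset.mul_sum, mul_div_assoc]

lemma hardAvg_const {m : ℕ} (hm : 1000 ≤ m) (hβ : Fintype.card β = 8 * m ^ 18) (hn : 1 < n)
    (h v : Bool) (a : ℝ) : hardAvg m h v (fun _ : β × Fin n → Bool => a) = a := by
  unfold hardAvg
  simp only [urnAvg_const, urnWt_none (urn_hardCounts_nonempty hm hβ h v), mul_one,
    Finset.sum_const, nsmul_eq_mul]
  have h1 : ((keyPositions n).card : ℝ) ≠ 0 := by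
    rw [card_keyPositions (by omega)]
    exact_mod_cast (by omega : n - 1 ≠ 0)
  have h2 : ((evenBits β n).card : ℝ) ≠ 0 := by
    exact_mod_cast evenBits_nonempty.card_pos.ne'
  field_simp

lemma sum_div_le_of_forall {κ κ' : Type} {P : Finset κ} {E : Finset κ'} {f g : κ → κ' → ℝ}
    (hfg : ∀ p ∈ P, ∀ u ∈ E, f p u ≤ g p u) :
    (∑ p ∈ P, ∑ u ∈ E, f p u) / ((P.card : ℝ) * E.card) ≤
      (∑ p ∈ P, ∑ u ∈ E, g p u) / ((P.card : ℝ) * E.card) :=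
  div_le_div_of_nonneg_right
    (Finset.sum_le_sum fun p hp => Finset.sum_le_sum fun u hu => hfg p hp u hu) (by positivity)

/-- The average of the output of the stopped procedure. -/
noncomputable def procAvg (m : ℕ) (h v : Bool) (D : DecTree (β × Fin n)) : ℝ :=
  (∑ p ∈ keyPositions n, ∑ u ∈ evenBits β n,
    urnAvg (hardCounts m h v) (fun _ => none) (D.toProc p u fun _ => none).out) /
    ((keyPositions n).card * (evenBits β n).card)

/-- The average number of blocks revealed by the stopped procedure. -/
noncomputable def touchAvg (m : ℕ) (h v : Bool) (D : DecTree (β × Fin n)) : ℝ :=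
  (∑ p ∈ keyPositions n, ∑ u ∈ evenBits β n,
    urnAvg (hardCounts m h v) (fun _ => none) (D.toProc p u fun _ => none).touches) /
    ((keyPositions n).card * (evenBits β n).card)

lemma urnAvg_mono (c : Option Bool → ℝ) (k : β → Option (Option Bool))
    {F G : (β → Option Bool) → ℝ} (h : ∀ z, z ∈ urn c → Extends k z → F z ≤ G z) :
    urnAvg c k F ≤ urnAvg c k G := by
  classical
  unfold urnAvg
  gcongr with z hz
  exact h z (Finset.mem_filter.1 hz).1 (Finset.mem_filter.1 hz).2

lemma touchAvg_le (m : ℕ) (h v : Bool) (D : DecTree (β × Fin n)) :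
    touchAvg m h v D ≤ hardAvg m h v fun x => (D.cost x : ℝ) :=
  sum_div_le_of_forall fun p _ u _ => urnAvg_mono _ _ fun z _ hz => D.toProc_touches_le v p u _ z hz

lemma urn_ne_none {m : ℕ} {v : Bool} {z : β → Option Bool} (hz : z ∈ urn (hardCounts m false v))
    (i : β) : z i ≠ none := by
  simp only [urn, Finset.mem_filter, Finset.mem_univ, true_and] at hz
  have := hz none
  simp only [hardCounts, Bool.false_eq_true, if_false, Nat.cast_eq_zero, Finset.card_eq_zero] at this
  exact fun h => (Finset.eq_empty_iff_forall_notMem.1 this i) (by simp [h])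

/-- Without hard blocks there are no keys and the procedure follows the tree exactly. Exactness
matters, since this advantage is multiplied by `m` and an error of order cost over `n` would be too
large. -/
lemma hardAvg_eq_procAvg (m : ℕ) (v : Bool) (D : DecTree (β × Fin n)) :
    hardAvg m false v (fun x => bitSign (D.eval x)) = procAvg m false v D := by
  unfold hardAvg procAvg
  congr 1
  refine Finset.sum_congr rfl fun p _ => Finset.sum_congr rfl fun u _ => ?_
  have key : ∀ z ∈ urn (hardCounts m false v), Extends (fun _ => none) z →
      bitSign (D.eval (decode z (flipHard v p z u))) = (D.toProc p u fun _ => none).out z := by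
    intro z hz hk
    have h1 := D.abs_toProc_out_sub_le v p u _ z hk
    rw [D.hits_eq_zero _ (fun q hq => urn_ne_none hz q.1 hq.1)] at h1
    rw [Nat.cast_zero] at h1
    exact sub_eq_zero.1 (abs_nonpos_iff.1 h1)
  exact le_antisymm (urnAvg_mono _ _ fun z hz hk => (key z hz hk).le)
    (urnAvg_mono _ _ fun z hz hk => (key z hz hk).ge)

lemma sum_urnAvg_none {κ κ' : Type} (P : Finset κ) (E : Finset κ') (c : Option Bool → ℝ)
    (F : κ → κ' → (β → Option Bool) → ℝ) :
    ∑ p ∈ P, ∑ u ∈ E, urnAvg c (fun _ => none) (F p u) =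
      (∑ z ∈ urn (β := β) c, ∑ p ∈ P, ∑ u ∈ E, F p u z) / (urn (β := β) c).card := by
  simp only [urnAvg_none, ← Finset.sum_div]
  congr 1
  rw [Finset.sum_congr rfl fun p _ => Finset.sum_comm, Finset.sum_comm]

/-- The difference is at most the probability of querying a key, and the position `p` is uniform
among `n - 1` and independent of the input. -/
lemma abs_hardAvg_sub_procAvg_le (m : ℕ) (h v : Bool) (hn : 1 < n) (D : DecTree (β × Fin n)) :
    |hardAvg m h v (fun x => bitSign (D.eval x)) - procAvg m h v D| ≤
      (hardAvg m h v fun x => (D.cost x : ℝ)) / (n - 1) := by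
  have hn1 : (0 : ℝ) < n - 1 := by
    have : (1 : ℝ) < n := by exact_mod_cast hn
    linarith
  have h1 : |hardAvg m h v (fun x => bitSign (D.eval x)) - procAvg m h v D| ≤
      (∑ p ∈ keyPositions n, ∑ u ∈ evenBits β n,
        urnAvg (hardCounts m h v) (fun _ => none) fun z =>
          (D.hits (IsKey p z) (decode z (flipHard v p z u)) : ℝ)) /
      ((keyPositions n).card * (evenBits β n).card) := by
    have h2 : ∀ p u, urnAvg (hardCounts m h v) (fun _ => none)
          (fun z => bitSign (D.eval (decode z (flipHard v p z u)))) ≤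
        urnAvg (hardCounts m h v) (fun _ => none) (D.toProc p u fun _ => none).out +
        urnAvg (hardCounts m h v) (fun _ => none) (fun z =>
          (D.hits (IsKey p z) (decode z (flipHard v p z u)) : ℝ)) := by
      intro p u
      rw [← urnAvg_add]
      refine urnAvg_mono _ _ fun z _ hz => ?_
      linarith [(abs_le.1 (D.abs_toProc_out_sub_le v p u _ z hz)).2]
    have h3 : ∀ p u, urnAvg (hardCounts m h v) (fun _ => none) (D.toProc p u fun _ => none).out ≤
        urnAvg (hardCounts m h v) (fun _ => none)
          (fun z => bitSign (D.eval (decode z (flipHard v p z u)))) +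
        urnAvg (hardCounts m h v) (fun _ => none) (fun z =>
          (D.hits (IsKey p z) (decode z (flipHard v p z u)) : ℝ)) := by
      intro p u
      rw [← urnAvg_add]
      refine urnAvg_mono _ _ fun z _ hz => ?_
      linarith [(abs_le.1 (D.abs_toProc_out_sub_le v p u _ z hz)).1]
    have h4 := sum_div_le_of_forall (P := keyPositions n) (E := evenBits β n)
      fun p _ u _ => h2 p u
    have h5 := sum_div_le_of_forall (P := keyPositions n) (E := evenBits β n)
      fun p _ u _ => h3 p u
    simp only [Finset.sum_add_distrib, add_div] at h4 h5
    unfold hardAvg procAvg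
    rw [abs_le]; constructor <;> linarith
  refine h1.trans ?_
  rw [le_div_iff₀ hn1]
  unfold hardAvg
  rw [div_mul_eq_mul_div]
  refine div_le_div_of_nonneg_right ?_ (by positivity)
  rw [sum_urnAvg_none, sum_urnAvg_none, div_mul_eq_mul_div]
  refine div_le_div_of_nonneg_right ?_ (by positivity)
  rw [Finset.sum_mul]
  refine Finset.sum_le_sum fun z _ => ?_
  rw [mul_comm]
  exact sum_hits_le_sum_cost v z D (by omega)

/-- The combined advantage of a deterministic tree over the four hard distributions is bounded by
its cost. -/
lemma combined_advantage_le {m : ℕ} (hm : 1000 ≤ m) (hβ : Fintype.card β = 8 * m ^ 18)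
    (hn : n = m ^ 4) (D : DecTree (β × Fin n)) :
    m * (hardAvg m false true (fun x => bitSign (D.eval x)) -
        hardAvg m false false (fun x => bitSign (D.eval x))) +
      (hardAvg m true true (fun x => bitSign (D.eval x)) -
        hardAvg m true false (fun x => bitSign (D.eval x))) ≤
    3000 / (m : ℝ) ^ 4 * ∑ h, ∑ v, hardAvg m h v fun x => (D.cost x : ℝ) := by
  have hmR : (1000 : ℝ) ≤ m := by exact_mod_cast hm
  have hm0 : (0 : ℝ) < m := by linarith
  have hβR : (Fintype.card β : ℝ) = 8 * (m : ℝ) ^ 18 := by rw [hβ]; push_cast; ring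
  have hwt : ∀ h v, urnWt (hardCounts m h v) (fun _ : β => none) = 1 := fun h v =>
    urnWt_none (urn_hardCounts_nonempty hm hβ h v)
  -- At the root all four weights are 1 and nothing is known, so only the term with the touches
  -- survives.
  have hproc : m * (procAvg m false true D - procAvg m false false D) +
      (procAvg m true true D - procAvg m true false D) ≤
      2000 / (m : ℝ) ^ 4 * ∑ h, ∑ v, touchAvg m h v D := by
    have key : ∀ p ∈ keyPositions n, ∀ u ∈ evenBits β n, _ := fun p _ u _ =>
      (le_abs_self _).trans (BlockProc.abs_combined_le hmR hβR _ _
        (D.toProc_fresh p u fun _ => none) (seen_none none) (by rw [known_none]; positivity)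
        (by intro h v h' v'; rw [known_none, hwt, hwt]; simp))
    have h1 := sum_div_le_of_forall key
    simp only [hwt, known_none, sub_self, mul_zero, add_zero, abs_zero, hell_self zero_le_one,
      zero_add, Nat.cast_zero, zero_mul, Fintype.sum_bool, Finset.sum_add_distrib,
      Finset.sum_sub_distrib, ← Finset.mul_sum, add_div, sub_div, mul_div_assoc] at h1
    simp only [Fintype.sum_bool]
    unfold procAvg touchAvg
    refine h1.trans (le_of_eq ?_)
    ring
  have hC : ∀ h v, 0 ≤ hardAvg m h v fun x : β × Fin n → Bool => (D.cost x : ℝ) := by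
    intro h v
    unfold hardAvg
    refine div_nonneg (Finset.sum_nonneg fun p _ => Finset.sum_nonneg fun u _ =>
      urnAvg_nonneg _ _ fun z => Nat.cast_nonneg _) (by positivity)
  have hT : ∑ h, ∑ v, touchAvg m h v D ≤ ∑ h, ∑ v, hardAvg m h v fun x => (D.cost x : ℝ) :=
    Finset.sum_le_sum fun h _ => Finset.sum_le_sum fun v _ => touchAvg_le m h v D
  have hn1 : 1 < n := by rw [hn]; exact Nat.one_lt_pow (by norm_num) (by omega)
  have hdev : ∀ v, |hardAvg m true v (fun x => bitSign (D.eval x)) - procAvg m true v D| ≤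
      1000 / (m : ℝ) ^ 4 * hardAvg m true v fun x => (D.cost x : ℝ) := by
    intro v
    refine (abs_hardAvg_sub_procAvg_le m true v hn1 D).trans ?_
    rw [div_eq_mul_inv, mul_comm]
    refine mul_le_mul_of_nonneg_right ?_ (hC _ _)
    have h4 : (1 : ℝ) ≤ (m : ℝ) ^ 4 - 1 := by
      have : (m : ℝ) ≤ m ^ 4 := le_self_pow₀ (by linarith) (by norm_num)
      linarith
    rw [hn]
    push_cast
    rw [inv_eq_one_div, div_le_div_iff₀ (by linarith) (by positivity)]
    linarith
  have h1 := (abs_le.1 (hdev true)).2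
  have h2 := (abs_le.1 (hdev false)).1
  rw [hardAvg_eq_procAvg, hardAvg_eq_procAvg]
  have h3 := mul_le_mul_of_nonneg_left hT (by positivity : 0 ≤ 2000 / (m : ℝ) ^ 4)
  have h4 : 3000 / (m : ℝ) ^ 4 * ∑ h, ∑ v, hardAvg m h v (fun x : β × Fin n → Bool => (D.cost x : ℝ))
      = 2000 / (m : ℝ) ^ 4 * ∑ h, ∑ v, hardAvg m h v (fun x : β × Fin n → Bool => (D.cost x : ℝ)) +
      1000 / (m : ℝ) ^ 4 * ∑ h, ∑ v, hardAvg m h v (fun x : β × Fin n → Bool => (D.cost x : ℝ)) := by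
    ring
  rw [h4]
  refine le_trans ?_ (add_le_add (hproc.trans h3) le_rfl)
  simp only [Fintype.sum_bool]
  have g1 := mul_nonneg (by positivity : 0 ≤ 1000 / (m : ℝ) ^ 4) (hC false true)
  have g2 := mul_nonneg (by positivity : 0 ≤ 1000 / (m : ℝ) ^ 4) (hC false false)
  linarith

/-- The advantage of a deterministic tree on inputs without hard blocks is bounded by its cost. -/
lemma advantage_le {m : ℕ} (hm : 1000 ≤ m) (hβ : Fintype.card β = 8 * m ^ 18)
    (hn : n = m ^ 4) (D : DecTree (β × Fin n)) :
    hardAvg m false true (fun x => bitSign (D.eval x)) -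
        hardAvg m false false (fun x => bitSign (D.eval x)) ≤
    2 / (m : ℝ) ^ 3 * ∑ v, hardAvg m false v fun x => (D.cost x : ℝ) := by
  have hmR : (1000 : ℝ) ≤ m := by exact_mod_cast hm
  have hm0 : (0 : ℝ) < m := by linarith
  have hβR : (Fintype.card β : ℝ) = 8 * (m : ℝ) ^ 18 := by rw [hβ]; push_cast; ring
  have hwt : ∀ h v, urnWt (hardCounts m h v) (fun _ : β => none) = 1 := fun h v =>
    urnWt_none (urn_hardCounts_nonempty hm hβ h v)
  have hn1 : 1 < n := by rw [hn]; exact Nat.one_lt_pow (by norm_num) (by omega)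
  have hconst := fun v a => hardAvg_const (n := n) hm hβ hn1 false v a
  -- A leaf has no advantage. Any other tree makes at least one query, which pays for the fixed loss
  -- `2 / m ^ 3`.
  cases D with
  | leaf b =>
    simp only [DecTree.eval, DecTree.cost, hconst]
    simp
  | query q t₀ t₁ =>
    generalize hD : DecTree.query q t₀ t₁ = D
    have hC : ∀ v, 1 ≤ hardAvg m false v fun x : β × Fin n → Bool => (D.cost x : ℝ) := by
      intro v
      rw [← hconst v 1]
      refine hardAvg_mono _ _ _ fun x => ?_
      rw [← hD]
      simp [DecTree.cost]
      positivity
    have hproc : procAvg m false true D - procAvg m false false D ≤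
        2 / (m : ℝ) ^ 3 + 8 / (m : ℝ) ^ 5 * ∑ v, touchAvg m false v D := by
      have key : ∀ p ∈ keyPositions n, ∀ u ∈ evenBits β n, _ := fun p _ u _ =>
        (le_abs_self _).trans (BlockProc.abs_sub_le_of_no_hard hmR hβR _ _
          (D.toProc_fresh p u fun _ => none))
      have h1 := sum_div_le_of_forall key
      have h0 := hconst true (2 / (m : ℝ) ^ 3)
      unfold hardAvg at h0
      simp only [urnAvg_const, hwt, mul_one] at h0
      simp only [hwt, known_none, mul_zero, hell_self zero_le_one,
        zero_add, Nat.cast_zero, zero_mul, Finset.sum_add_distrib,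
        Finset.sum_sub_distrib, ← Finset.mul_sum, add_div, sub_div, mul_div_assoc] at h1
      simp only [Fintype.sum_bool]
      unfold procAvg touchAvg
      refine h1.trans (le_of_eq ?_)
      rw [← h0]
      simp only [Finset.sum_const, nsmul_eq_mul]
      ring
    rw [hardAvg_eq_procAvg, hardAvg_eq_procAvg]
    have h1 := touchAvg_le m false true D
    have h2 := touchAvg_le m false false D
    have h3 := hC true
    have h4 := hC false
    simp only [Fintype.sum_bool] at hproc ⊢
    have h5 : 8 / (m : ℝ) ^ 5 ≤ 1 / (m : ℝ) ^ 3 := by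
      rw [div_le_div_iff₀ (by positivity) (by positivity)]
      have : (m : ℝ) ^ 5 = m ^ 2 * m ^ 3 := by ring
      rw [this, one_mul]
      gcongr
      nlinarith
    set C := (hardAvg m false true fun x : β × Fin n → Bool => (D.cost x : ℝ)) +
      hardAvg m false false fun x : β × Fin n → Bool => (D.cost x : ℝ)
    have h6 : 8 / (m : ℝ) ^ 5 * (touchAvg m false true D + touchAvg m false false D) ≤
        1 / (m : ℝ) ^ 3 * C := by
      refine (mul_le_mul_of_nonneg_left (add_le_add h1 h2) (by positivity)).trans ?_
      exact mul_le_mul_of_nonneg_right h5 (by linarith)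
    have h7 : 2 / (m : ℝ) ^ 3 ≤ 1 / (m : ℝ) ^ 3 * C := by
      rw [div_eq_mul_one_div, mul_comm]
      exact mul_le_mul_of_nonneg_left (by linarith) (by positivity)
    have h8 : 2 / (m : ℝ) ^ 3 * C = 1 / (m : ℝ) ^ 3 * C + 1 / (m : ℝ) ^ 3 * C := by ring
    linarith

end Average

/-! ### The lower bounds for `ULR` and `LR` -/

lemma DecTree.coe_err {ι : Type} {f : PartialBoolFun ι} {x : ι → Bool} {v : Bool}
    (hf : f x = some v) (D : DecTree ι) :
    (D.err f x : ℝ) = (1 - bitSign v * bitSign (D.eval x)) / 2 := by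
  unfold DecTree.err
  rw [hf]
  cases hD : D.eval x <;> cases v <;> simp [bitSign]

section HardInputs

variable (m : ℕ)

/-- The parameters of the hard inputs. -/
abbrev HardIndex : Type :=
  (_ : Bool × Bool) × (Fin (m ^ 4) × (Fin (8 * m ^ 18) × Fin (m ^ 4) → Bool) ×
    (Fin (8 * m ^ 18) → Option Bool))

/-- The range of the parameters of the hard inputs. -/
noncomputable def hardIndices : Finset (HardIndex m) :=
  Finset.univ.sigma fun hv => keyPositions (m ^ 4) ×ˢ evenBits (Fin (8 * m ^ 18)) (m ^ 4) ×ˢ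
    urn (hardCounts m hv.1 hv.2)

variable {m}

/-- The hard inputs. -/
def hardInput (a : HardIndex m) : Fin (8 * m ^ 18) × Fin (m ^ 4) → Bool :=
  decode a.2.2.2 (flipHard a.1.2 a.2.1 a.2.2.2 a.2.2.1)

/-- The weight of a hard input in its distribution. -/
noncomputable def hardWeight (a : HardIndex m) : ℝ≥0 :=
  (((keyPositions (m ^ 4)).card * (evenBits (Fin (8 * m ^ 18)) (m ^ 4)).card *
    (urn (β := Fin (8 * m ^ 18)) (hardCounts m a.1.1 a.1.2)).card : ℕ) : ℝ≥0)⁻¹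

lemma sum_hardIndices (r : Bool → Bool → ℝ)
    (F : Bool → (Fin (8 * m ^ 18) × Fin (m ^ 4) → Bool) → ℝ) :
    ∑ a ∈ hardIndices m, r a.1.1 a.1.2 * (hardWeight a : ℝ) * F a.1.2 (hardInput a) =
      ∑ h, ∑ v, r h v * hardAvg m h v (F v) := by
  unfold hardIndices
  rw [Finset.sum_sigma, Fintype.sum_prod_type]
  refine Finset.sum_congr rfl fun h _ => Finset.sum_congr rfl fun v _ => ?_
  unfold hardAvg
  simp only [Finset.sum_product, urnAvg_none, hardWeight, hardInput, ← Finset.mul_sum,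
    ← Finset.sum_div]
  push_cast
  rw [mul_inv, mul_inv]
  ring

lemma hardInput_mem {a : HardIndex m} (hm : 1000 ≤ m) (ha : a ∈ hardIndices m) :
    sepFamily m (hardInput a) = some a.1.2 := by
  classical
  obtain ⟨⟨h, v⟩, p, u, z⟩ := a
  simp only [hardIndices, Finset.mem_sigma, Finset.mem_univ, true_and, Finset.mem_product] at ha
  obtain ⟨hp, hu, hz⟩ := ha
  refine sepFamily_decode hm hz fun i hi => ?_
  have hp' := (Finset.mem_filter.1 hp).2
  have hu' := mem_evenBits.1 hu i
  rw [oddBlock_flipHard hp']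
  dsimp only at hi ⊢
  cases v <;> simp [hi, hu']

/-- Transfer of an inequality for averages over the hard distributions to weighted sums. -/
lemma sum_hardWeight_le {ι : Type} (hm : 1000 ≤ m) (e : Fin (8 * m ^ 18) × Fin (m ^ 4) ↪ ι)
    (lam κ : Bool → ℝ≥0)
    (H : ∀ D : DecTree (Fin (8 * m ^ 18) × Fin (m ^ 4)),
      ∑ h, ∑ v, lam h * bitSign v * hardAvg m h v (fun x => bitSign (D.eval x)) ≤
        ∑ h, ∑ v, κ h * hardAvg m h v fun x => (D.cost x : ℝ)) (D : DecTree ι) :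
    ∑ a ∈ hardIndices m, lam a.1.1 * hardWeight a ≤
      ∑ a ∈ hardIndices m, κ a.1.1 * hardWeight a * (D.cost (extendInput e (hardInput a)) : ℝ≥0) +
      2 * ∑ a ∈ hardIndices m, lam a.1.1 * hardWeight a *
        D.err (fun x => sepFamily m (x ∘ e)) (extendInput e (hardInput a)) := by
  have hn1 : 1 < m ^ 4 := Nat.one_lt_pow (by norm_num) (by omega)
  have hconst := fun h v a => hardAvg_const (β := Fin (8 * m ^ 18)) hm (by simp) hn1 h v a
  rw [← NNReal.coe_le_coe]
  push_cast
  have h1 : ∑ a ∈ hardIndices m, (lam a.1.1 : ℝ) * (hardWeight a : ℝ) = ∑ h, ∑ v : Bool, (lam h : ℝ) := by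
    have := sum_hardIndices (m := m) (fun h _ => (lam h : ℝ)) (fun _ _ => 1)
    simp only [hconst, mul_one] at this
    exact this
  have h2 : ∑ a ∈ hardIndices m, (lam a.1.1 : ℝ) * (hardWeight a : ℝ) *
      (D.err (fun x => sepFamily m (x ∘ e)) (extendInput e (hardInput a)) : ℝ) =
      ∑ h, ∑ v, (lam h : ℝ) * ((1 - bitSign v * hardAvg m h v
        (fun x => bitSign ((D.restrict e).eval x))) / 2) := by
    have h3 := sum_hardIndices (m := m) (fun h _ => (lam h : ℝ))
      (fun v x => 1 / 2 + (-(bitSign v) / 2) * bitSign ((D.restrict e).eval x))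
    have h4 : ∀ a ∈ hardIndices m, (lam a.1.1 : ℝ) * (hardWeight a : ℝ) *
      (D.err (fun x => sepFamily m (x ∘ e)) (extendInput e (hardInput a)) : ℝ) =
      (lam a.1.1 : ℝ) * (hardWeight a : ℝ) * (1 / 2 + (-(bitSign a.1.2) / 2) *
        bitSign ((D.restrict e).eval (hardInput a))) := by
      intro a ha
      rw [DecTree.coe_err (v := a.1.2), DecTree.eval_restrict]
      · ring
      · rw [extendInput_comp]; exact hardInput_mem hm ha
    rw [Finset.sum_congr rfl h4, h3]
    refine Finset.sum_congr rfl fun h _ => Finset.sum_congr rfl fun v _ => ?_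
    rw [hardAvg_add, hardAvg_mul_left, hconst]
    ring
  have h5 : ∑ h, ∑ v, (κ h : ℝ) * hardAvg m h v (fun x => ((D.restrict e).cost x : ℝ)) ≤
      ∑ a ∈ hardIndices m, (κ a.1.1 : ℝ) * (hardWeight a : ℝ) *
        (D.cost (extendInput e (hardInput a)) : ℝ) := by
    rw [← sum_hardIndices (m := m) (fun h _ => (κ h : ℝ)) (fun _ x => ((D.restrict e).cost x : ℝ))]
    refine Finset.sum_le_sum fun a _ => ?_
    gcongr
    exact D.cost_restrict_le e _
  rw [h1, h2]
  have h6 := H (D.restrict e)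
  have h7 : ∑ h, ∑ v, (lam h : ℝ) * ((1 - bitSign v * hardAvg m h v
        (fun x => bitSign ((D.restrict e).eval x))) / 2) =
      (∑ h, ∑ v : Bool, (lam h : ℝ)) / 2 - (∑ h, ∑ v, lam h * bitSign v * hardAvg m h v
        (fun x => bitSign ((D.restrict e).eval x))) / 2 := by
    simp only [Fintype.sum_bool]; ring
  rw [h7]
  linarith

lemma sum_hardWeight (hm : 1000 ≤ m) (lam : Bool → ℝ≥0) :
    ∑ a ∈ hardIndices m, lam a.1.1 * hardWeight a = 2 * (lam true + lam false) := by
  have hn1 : 1 < m ^ 4 := Nat.one_lt_pow (by norm_num) (by omega)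
  have hconst := fun h v a => hardAvg_const (β := Fin (8 * m ^ 18)) hm (by simp) hn1 h v a
  have := sum_hardIndices (m := m) (fun h _ => (lam h : ℝ)) (fun _ _ => 1)
  simp only [hconst, mul_one, Fintype.sum_bool] at this
  rw [← NNReal.coe_inj]
  push_cast
  rw [this]; ring

lemma hardInput_mem_dom {ι : Type} (hm : 1000 ≤ m) (e : Fin (8 * m ^ 18) × Fin (m ^ 4) ↪ ι)
    {a : HardIndex m} (ha : a ∈ hardIndices m) :
    extendInput e (hardInput a) ∈ PartialBoolFun.Dom (fun x => sepFamily m (x ∘ e)) := by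
  simp [PartialBoolFun.Dom, extendInput_comp, hardInput_mem hm ha]

/-- The lower bound for `ULR`. -/
lemma pow_five_le_ULR {ι : Type} (hm : 1000 ≤ m) (e : Fin (8 * m ^ 18) × Fin (m ^ 4) ↪ ι) :
    (m : ℝ≥0∞) ^ 5 ≤ 6000 * ULR (fun x : ι → Bool => sepFamily m (x ∘ e)) := by
  have hm0 : (0 : ℝ≥0) < m := by exact_mod_cast (by omega : 0 < m)
  -- The bias weights `m` and 1 are those of `combined_advantage_le`. The totals are `2 * (1 + m)`
  -- for the bias and `12000 / m ^ 4` for the cost.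
  have h := le_ULR (f := fun x : ι → Bool => sepFamily m (x ∘ e)) (hardIndices m)
    (fun a => extendInput e (hardInput a)) (fun a ha => hardInput_mem_dom hm e ha)
    (fun a => (fun h => if h then 1 else (m : ℝ≥0)) a.1.1 * hardWeight a)
    (fun a => (fun _ => 3000 / (m : ℝ≥0) ^ 4) a.1.1 * hardWeight a) ?_
    (sum_hardWeight_le hm e (fun h => if h then 1 else (m : ℝ≥0)) (fun _ => 3000 / (m : ℝ≥0) ^ 4) ?_)
  · rw [sum_hardWeight hm fun h => if h then 1 else (m : ℝ≥0),
      sum_hardWeight hm fun _ => 3000 / (m : ℝ≥0) ^ 4] at h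
    simp only [Bool.false_eq_true, if_false, if_true] at h
    set U := ULR (fun x : ι → Bool => sepFamily m (x ∘ e))
    have h1 : ((2 * (1 + m) : ℝ≥0) : ℝ≥0∞) * ((m ^ 4 / 2 : ℝ≥0) : ℝ≥0∞) ≤
        ((2 * (3000 / (m : ℝ≥0) ^ 4 + 3000 / (m : ℝ≥0) ^ 4) : ℝ≥0) : ℝ≥0∞) * U *
          ((m ^ 4 / 2 : ℝ≥0) : ℝ≥0∞) := by gcongr
    rw [mul_right_comm, ← ENNReal.coe_mul, ← ENNReal.coe_mul] at h1
    have h2 : 2 * (3000 / (m : ℝ≥0) ^ 4 + 3000 / (m : ℝ≥0) ^ 4) * (m ^ 4 / 2) = 6000 := by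
      field_simp; norm_num
    rw [h2] at h1
    refine le_trans ?_ h1
    have h3 : (m : ℝ≥0) ^ 5 ≤ 2 * (1 + m) * (m ^ 4 / 2) := by
      have : 2 * (1 + (m : ℝ≥0)) * (m ^ 4 / 2) = m ^ 5 + m ^ 4 := by
        field_simp; ring
      rw [this]; exact le_self_add
    exact_mod_cast ENNReal.coe_le_coe.2 h3
  · rw [sum_hardWeight hm fun _ => 3000 / (m : ℝ≥0) ^ 4]
    positivity
  · intro D
    have := combined_advantage_le hm (by simp) rfl D
    rw [Finset.mul_sum] at this
    simp only [Finset.mul_sum] at this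
    simp only [Fintype.sum_bool, Bool.false_eq_true, if_false, if_true, bitSign] at this ⊢
    push_cast
    linarith

/-- A polynomial lower bound for `LR`. -/
lemma pow_three_le_LR {ι : Type} (hm : 1000 ≤ m) (e : Fin (8 * m ^ 18) × Fin (m ^ 4) ↪ ι) :
    (m : ℝ≥0∞) ^ 3 ≤ 2 * LR (fun x : ι → Bool => sepFamily m (x ∘ e)) := by
  have hm0 : (0 : ℝ≥0) < m := by exact_mod_cast (by omega : 0 < m)
  -- Inputs without hard blocks alone give order `m ^ 3`, which is enough for polynomial growth of
  -- `LR`.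
  have h := le_LR (f := fun x : ι → Bool => sepFamily m (x ∘ e)) (hardIndices m)
    (fun a => extendInput e (hardInput a)) (fun a ha => hardInput_mem_dom hm e ha)
    (fun a => (fun h => if h then 0 else (1 : ℝ≥0)) a.1.1 * hardWeight a)
    (2 / (m : ℝ≥0) ^ 3) (by positivity) ?_ ?_
  · set U := LR (fun x : ι → Bool => sepFamily m (x ∘ e))
    have h1 : ((m ^ 3 : ℝ≥0) : ℝ≥0∞) * 1 ≤ ((m ^ 3 : ℝ≥0) : ℝ≥0∞) *
        (((2 / (m : ℝ≥0) ^ 3 : ℝ≥0) : ℝ≥0∞) * U) := by gcongr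
    rw [mul_one, ← mul_assoc, ← ENNReal.coe_mul] at h1
    have h2 : (m : ℝ≥0) ^ 3 * (2 / (m : ℝ≥0) ^ 3) = 2 := by field_simp
    rw [h2] at h1
    exact_mod_cast h1
  · rw [sum_hardWeight hm fun h => if h then 0 else (1 : ℝ≥0)]
    simp
  · intro D
    have h1 := sum_hardWeight_le hm e (fun h => if h then 0 else (1 : ℝ≥0))
      (fun h => 2 / (m : ℝ≥0) ^ 3 * if h then 0 else (1 : ℝ≥0)) ?_ D
    · simpa only [mul_assoc] using h1
    · intro D
      have := advantage_le hm (by simp) rfl D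
      simp only [Fintype.sum_bool, Bool.false_eq_true, if_false, if_true, bitSign] at this ⊢
      push_cast
      linarith

end HardInputs

/-! ### The upper bound for `LR`: evaluating a random block -/

section UpperBound

/-- The tree that queries all bits of a list and outputs their parity. -/
def parityTree {ι : Type} : List ι → Bool → DecTree ι
  | [], b => .leaf b
  | q :: l, b => .query q (parityTree l b) (parityTree l !b)

lemma parityTree_eval {ι : Type} (l : List ι) (b : Bool) (x : ι → Bool) :
    (parityTree l b).eval x = xor b (decide (Odd (l.countP fun q => x q))) := by
  induction l generalizing b with
  | nil => simp [parityTree, DecTree.eval]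
  | cons q l ih =>
    simp only [parityTree, DecTree.eval, ih, List.countP_cons]
    cases hq : x q
    · simp
    · simp only [if_true, Nat.odd_add_one, decide_not]
      cases b <;> simp

lemma parityTree_cost {ι : Type} (l : List ι) (b : Bool) (x : ι → Bool) :
    (parityTree l b).cost x = l.length := by
  induction l generalizing b with
  | nil => rfl
  | cons q l ih => simp [parityTree, DecTree.cost, ih]

lemma parityTree_queries {ι : Type} (l : List ι) (b : Bool) (i : ι)
    (h : (parityTree l b).Queries i) : i ∈ l := by
  induction l generalizing b with
  | nil => exact h.elim
  | cons q l ih =>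
    rcases h with h | h | h
    · simp [h]
    · exact List.mem_cons_of_mem _ (ih _ h)
    · exact List.mem_cons_of_mem _ (ih _ h)

lemma parityTree_readOnce {ι : Type} (l : List ι) (b : Bool) (h : l.Nodup) :
    (parityTree l b).ReadOnce := by
  induction l generalizing b with
  | nil => trivial
  | cons q l ih =>
    rw [List.nodup_cons] at h
    exact ⟨fun h' => h.1 (parityTree_queries _ _ _ h'), fun h' => h.1 (parityTree_queries _ _ _ h'),
      ih _ h.2, ih _ h.2⟩

variable {ι : Type} {n B : ℕ}

/-- The positions of a block except the first. -/
def blockList (e : Fin B × Fin n ↪ ι) (i : Fin B) : List ι :=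
  ((List.finRange n).filter fun j => 0 < j.val).map fun j => e (i, j)

/-- The tree that determines the value of the block `i`. -/
def blockTree (hn : 1 < n) (e : Fin B × Fin n ↪ ι) (i : Fin B) : DecTree ι :=
  .query (e (i, ⟨0, by omega⟩)) (.query (e (i, ⟨1, hn⟩)) (.leaf false) (.leaf true))
    (parityTree (blockList e i) false)

lemma blockTree_readOnce (hn : 1 < n) (e : Fin B × Fin n ↪ ι) (i : Fin B) :
    (blockTree hn e i).ReadOnce := by
  refine ⟨?_, ?_, ?_, ?_⟩
  · rintro (h | h | h)
    · have := e.injective h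
      simp at this
    · exact h
    · exact h
  · intro h
    have h1 := parityTree_queries _ _ _ h
    simp only [blockList, List.mem_map, List.mem_filter] at h1
    obtain ⟨j, hj, hje⟩ := h1
    have h2 := e.injective hje
    simp only [Prod.mk.injEq, true_and] at h2
    subst h2
    simp at hj
  · exact ⟨id, id, trivial, trivial⟩
  · refine parityTree_readOnce _ _ (List.Nodup.map ?_ ((List.nodup_finRange n).filter _))
    intro a b hab
    have := e.injective hab
    simpa using this

lemma blockTree_eval (hn : 1 < n) (e : Fin B × Fin n ↪ ι) (i : Fin B) (x : ι → Bool) :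
    (blockTree hn e i).eval x = blockValue fun j => (x ∘ e) (i, j) := by
  have h0 : 0 < n := by omega
  simp only [blockTree, DecTree.eval, blockValue, blockHard, blockBit, h0, hn, dif_pos,
    Function.comp_apply]
  split_ifs with _ h2
  · rw [parityTree_eval, Bool.false_xor, decide_eq_decide, blockList, List.countP_map,
      List.countP_filter, List.countP_eq_length_filter]
    have : (Finset.univ.filter fun j : Fin n => 0 < j.val ∧ x (e (i, j)) = true).card =
        ((List.finRange n).filter fun j => decide (0 < j.val ∧ x (e (i, j)) = true)).length := by
      rw [Fin.univ_def]; rfl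
    rw [this]
    have h3 : (fun a : Fin n => ((fun q => x q) ∘ fun j => e (i, j)) a && decide (0 < a.val)) =
        fun j => decide (0 < j.val ∧ x (e (i, j)) = true) := by
      funext j
      rw [Bool.eq_iff_iff]
      simp [and_comm]
    rw [h3]
  · exact h2.symm
  · simpa using h2

lemma blockTree_cost_le (hn : 1 < n) (e : Fin B × Fin n ↪ ι) (i : Fin B) (x : ι → Bool) :
    (blockTree hn e i).cost x ≤
      2 + if blockHard (fun j => (x ∘ e) (i, j)) = true then n else 0 := by
  have h0 : 0 < n := by omega
  simp only [blockTree, DecTree.cost, blockHard, blockBit, h0, dif_pos, Function.comp_apply]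
  split_ifs
  · rw [parityTree_cost, blockList, List.length_map]
    have := List.length_filter_le (fun j : Fin n => decide (0 < j.val)) (List.finRange n)
    rw [List.length_finRange] at this
    omega
  all_goals simp

/-- The randomised tree that determines the value of a uniformly random block. -/
noncomputable def sampleTree (hn : 1 < n) [NeZero B] (e : Fin B × Fin n ↪ ι) : RandTree ι :=
  (PMF.uniformOfFintype (Fin B)).map fun i => ⟨blockTree hn e i, blockTree_readOnce hn e i⟩

lemma PMF.tsum_map_mul {α γ : Type} (p : PMF α) (g : α → γ) (F : γ → ℝ≥0∞) :
    ∑' b, p.map g b * F b = ∑' a, p a * F (g a) := by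
  classical
  simp only [PMF.map_apply, ← ENNReal.tsum_mul_right]
  rw [ENNReal.tsum_comm]
  refine tsum_congr fun a => ?_
  rw [tsum_eq_single (g a)]
  · simp
  · intro b hb; simp [hb]

lemma sampleTree_tsum (hn : 1 < n) [NeZero B] (e : Fin B × Fin n ↪ ι)
    (F : {D : DecTree ι // D.ReadOnce} → ℝ≥0∞) :
    ∑' D, sampleTree hn e D * F D =
      (B : ℝ≥0∞)⁻¹ * ∑ i, F ⟨blockTree hn e i, blockTree_readOnce hn e i⟩ := by
  unfold sampleTree
  rw [PMF.tsum_map_mul, tsum_fintype]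
  simp [PMF.uniformOfFintype_apply, Finset.mul_sum]

lemma sampleTree_cost_le (hn : 1 < n) [NeZero B] (e : Fin B × Fin n ↪ ι) (x : ι → Bool) :
    (sampleTree hn e).cost x ≤ (B : ℝ≥0∞)⁻¹ * (2 * B + numHard (x ∘ e) * n : ℕ) := by
  unfold RandTree.cost
  rw [sampleTree_tsum]
  gcongr
  rw [← Nat.cast_sum, Nat.cast_le]
  refine (Finset.sum_le_sum fun i _ => blockTree_cost_le hn e i x).trans ?_
  rw [Finset.sum_add_distrib, ← Finset.sum_filter, Finset.sum_const, Finset.sum_const]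
  simp [numHard, mul_comm]

lemma sampleTree_err_le (hn : 1 < n) [NeZero B] (e : Fin B × Fin n ↪ ι) {f : PartialBoolFun ι}
    {x : ι → Bool} {v : Bool} (hf : f x = some v) :
    (sampleTree hn e).err f x = (B : ℝ≥0∞)⁻¹ * (B - numValue (x ∘ e) v : ℕ) := by
  rw [RandTree.err_eq, sampleTree_tsum]
  congr 1
  have h1 : ∀ i, ((blockTree hn e i).err f x : ℝ≥0∞) =
      ((if ¬ blockValue (fun j => (x ∘ e) (i, j)) = v then 1 else 0 : ℕ) : ℝ≥0∞) := by
    intro i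
    unfold DecTree.err
    rw [hf, blockTree_eval]
    by_cases h : blockValue (fun j => (x ∘ e) (i, j)) = v
    · rw [if_pos (congrArg some h), if_neg (not_not.2 h)]; simp
    · rw [if_neg fun h' => h (Option.some.inj h'), if_pos h]; simp
  simp only [h1]
  rw [← Nat.cast_sum, Nat.cast_inj, ← Finset.card_filter]
  have := Finset.card_filter_add_card_filter_not (s := (Finset.univ : Finset (Fin B)))
    (fun i => blockValue (fun j => (x ∘ e) (i, j)) = v)
  rw [Finset.card_univ, Fintype.card_fin] at this
  unfold numValue
  omega

lemma costBiasRatio_le {a b r : ℝ≥0∞} (hb : b ≠ 0) (h : a ≤ r * b) : costBiasRatio a b ≤ r := by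
  unfold costBiasRatio
  rw [if_neg hb]
  exact ENNReal.div_le_of_le_mul h

/-- A value held by a fraction `1 / 2 + b` of the blocks gives bias `2 * b`; `hc` bounds the average
cost of a block by `r` times that. -/
lemma sampleTree_ratio_le (hn : 1 < n) [NeZero B] (e : Fin B × Fin n ↪ ι) {f : PartialBoolFun ι}
    {x : ι → Bool} {v : Bool} (hf : f x = some v) {b r : ℝ} (hb : 0 < b) (hr : 0 ≤ r)
    (hval : (B : ℝ) / 2 + B * b ≤ numValue (x ∘ e) v)
    (hc : 2 * B + numHard (x ∘ e) * (n : ℝ) ≤ r * (2 * b) * B) :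
    costBiasRatio ((sampleTree hn e).cost x) ((sampleTree hn e).bias f x) ≤ ENNReal.ofReal r := by
  have hBR : (0 : ℝ) < B := by exact_mod_cast NeZero.pos B
  have hofReal : ∀ a : ℕ, (B : ℝ≥0∞)⁻¹ * (a : ℝ≥0∞) = ENNReal.ofReal (a / B) := by
    intro a
    rw [div_eq_mul_inv, mul_comm, ENNReal.ofReal_mul (by positivity),
      ENNReal.ofReal_inv_of_pos hBR, ENNReal.ofReal_natCast, ENNReal.ofReal_natCast]
  have hcost := sampleTree_cost_le hn e x
  have herr := sampleTree_err_le hn e hf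
  rw [hofReal] at hcost herr
  have hle : numValue (x ∘ e) v ≤ B := by
    have := numValue_add (x ∘ e)
    cases v <;> omega
  have hleR : (numValue (x ∘ e) v : ℝ) ≤ B := by exact_mod_cast hle
  have hb2 : b ≤ 1 / 2 := by
    refine le_of_mul_le_mul_left ?_ hBR
    linarith
  have herr' : (sampleTree hn e).err f x ≤ ENNReal.ofReal (1 / 2 - b) := by
    rw [herr]
    refine ENNReal.ofReal_le_ofReal ?_
    rw [div_le_iff₀ hBR, Nat.cast_sub hle]
    linarith
  have hbias : ENNReal.ofReal (2 * b) ≤ (sampleTree hn e).bias f x := by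
    unfold RandTree.bias
    have h2 : ENNReal.ofReal (2 * b) = 1 - 2 * ENNReal.ofReal (1 / 2 - b) := by
      have h3 : (2 : ℝ≥0∞) = ENNReal.ofReal 2 := by simp
      rw [h3, ← ENNReal.ofReal_mul (by norm_num), ← ENNReal.ofReal_one,
        ← ENNReal.ofReal_sub _ (by linarith)]
      congr 1; ring
    rw [h2]
    gcongr
  refine costBiasRatio_le ?_ ?_
  · have : 0 < ENNReal.ofReal (2 * b) := ENNReal.ofReal_pos.2 (by linarith)
    exact (this.trans_le hbias).ne'
  · have h1 : ENNReal.ofReal ((2 * B + numHard (x ∘ e) * n : ℕ) / B) ≤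
        ENNReal.ofReal (r * (2 * b)) := by
      refine ENNReal.ofReal_le_ofReal ?_
      rw [div_le_iff₀ hBR]
      push_cast
      exact hc
    rw [ENNReal.ofReal_mul hr] at h1
    exact hcost.trans (h1.trans (by gcongr))

/-- The upper bound for `LR`. -/
lemma LR_le {m : ℕ} (hm : 1000 ≤ m) (e : Fin (8 * m ^ 18) × Fin (m ^ 4) ↪ ι) :
    LR (fun x : ι → Bool => sepFamily m (x ∘ e)) ≤ 5 * ((m ^ 4 : ℕ) : ℝ≥0∞) := by
  have hmR : (1000 : ℝ) ≤ m := by exact_mod_cast hm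
  have hm0 : (0 : ℝ) < m := by linarith
  have hn : 1 < m ^ 4 := Nat.one_lt_pow (by norm_num) (by omega)
  have hB : 0 < 8 * m ^ 18 := by positivity
  have : NeZero (8 * m ^ 18) := ⟨hB.ne'⟩
  unfold LR
  refine iInf_le_of_le (sampleTree hn e) (iSup₂_le fun x hx => ?_)
  obtain ⟨v, hv⟩ := Option.ne_none_iff_exists'.1 hx
  have hr : (5 * ((m ^ 4 : ℕ) : ℝ≥0∞)) = ENNReal.ofReal (5 * (m ^ 4 : ℕ)) := by
    rw [ENNReal.ofReal_mul (by norm_num), ENNReal.ofReal_natCast]; simp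
  rw [hr]
  -- The two ratios are at most `2 / (2 / m ^ 4) = m ^ 4` and `(2 + 4 * m) / (2 / m ^ 3) = 2 * m ^ 4
  -- + m ^ 3`.
  rcases promise_of_sepFun hv with ⟨h0, h1⟩ | ⟨h0, h1⟩
  · refine sampleTree_ratio_le hn e hv (by positivity) (by positivity) h1 ?_
    rw [h0]
    push_cast
    have e1 : 5 * (m : ℝ) ^ 4 * (2 * (1 / (m : ℝ) ^ 4)) * (8 * (m : ℝ) ^ 18) =
        10 * (8 * (m : ℝ) ^ 18) := by field_simp; norm_num
    rw [e1]
    linarith [pow_pos hm0 18]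
  · refine sampleTree_ratio_le hn e hv (by positivity) (by positivity) h1 ?_
    rw [h0]
    push_cast
    have e1 : 2 * (8 * (m : ℝ) ^ 18) + 4 * (8 * (m : ℝ) ^ 18) * (1 / (m : ℝ) ^ 3) * (m : ℝ) ^ 4 =
        (2 + 4 * m) * (8 * (m : ℝ) ^ 18) := by field_simp
    have e2 : 5 * (m : ℝ) ^ 4 * (2 * (1 / (m : ℝ) ^ 3)) * (8 * (m : ℝ) ^ 18) =
        10 * m * (8 * (m : ℝ) ^ 18) := by field_simp; norm_num
    rw [e1, e2]
    gcongr
    linarith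

end UpperBound

/-! ### Constants and conclusion -/

lemma ENNReal.pow_four_rpow (a : ℝ≥0∞) : (a ^ 4) ^ (5 / 4 : ℝ) = a ^ 5 := by
  rw [← ENNReal.rpow_natCast, ← ENNReal.rpow_mul, ← ENNReal.rpow_natCast]
  norm_num

/-- The separation for an embedded copy of a member of the family. -/
lemma sepFamily_separation {ι : Type} {m : ℕ} (hm : 3000 ≤ m)
    (e : Fin (8 * m ^ 18) × Fin (m ^ 4) ↪ ι) :
    LR (fun x : ι → Bool => sepFamily m (x ∘ e)) ≤ 5 * ((m ^ 4 : ℕ) : ℝ≥0∞) ∧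
    ((1 / 150000 : ℝ≥0) : ℝ≥0∞) * ((m ^ 4 : ℕ) : ℝ≥0∞) ^ (5 / 4 : ℝ) ≤
      ULR (fun x : ι → Bool => sepFamily m (x ∘ e)) ∧
    ((1 / 150000 : ℝ≥0) : ℝ≥0∞) * LR (fun x : ι → Bool => sepFamily m (x ∘ e)) ^ (5 / 4 : ℝ) ≤
      ULR (fun x : ι → Bool => sepFamily m (x ∘ e)) ∧
    16 * (m : ℝ≥0∞) ≤
      ((1 / 150000 : ℝ≥0) : ℝ≥0∞) * LR (fun x : ι → Bool => sepFamily m (x ∘ e)) ^ (5 / 4 : ℝ) := by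
  have hU := pow_five_le_ULR (by omega : 1000 ≤ m) e
  have hL := pow_three_le_LR (by omega : 1000 ≤ m) e
  have hL' := LR_le (by omega : 1000 ≤ m) e
  set U := ULR (fun x : ι → Bool => sepFamily m (x ∘ e))
  set L := LR (fun x : ι → Bool => sepFamily m (x ∘ e))
  have hcoef : ((1 / 150000 : ℝ≥0) : ℝ≥0∞) * 6000 ≤ 1 := by
    have : (1 / 150000 : ℝ≥0) * 6000 ≤ 1 := by
      rw [← NNReal.coe_le_coe]; push_cast; norm_num
    exact_mod_cast ENNReal.coe_le_coe.2 this
  -- `150000 = 25 * 6000`: 6000 comes from `pow_five_le_ULR`, and 25 bounds `5 ^ (5 / 4)`, the power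
  -- of the constant in `LR_le`.
  have hcoef' : ((1 / 150000 : ℝ≥0) : ℝ≥0∞) * 25 * 6000 ≤ 1 := by
    have : (1 / 150000 : ℝ≥0) * 25 * 6000 ≤ 1 := by
      rw [← NNReal.coe_le_coe]; push_cast; norm_num
    exact_mod_cast ENNReal.coe_le_coe.2 this
  have h5 : (5 : ℝ≥0∞) ^ (5 / 4 : ℝ) ≤ 25 := by
    calc (5 : ℝ≥0∞) ^ (5 / 4 : ℝ) ≤ (5 : ℝ≥0∞) ^ (2 : ℝ) :=
          ENNReal.rpow_le_rpow_of_exponent_le (by norm_num) (by norm_num)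
      _ = 25 := by
        have : (2 : ℝ) = ((2 : ℕ) : ℝ) := by norm_num
        rw [this, ENNReal.rpow_natCast]; norm_num
  refine ⟨hL', ?_, ?_, ?_⟩
  · push_cast
    rw [ENNReal.pow_four_rpow]
    calc _ ≤ ((1 / 150000 : ℝ≥0) : ℝ≥0∞) * (6000 * U) := by gcongr
      _ = ((1 / 150000 : ℝ≥0) : ℝ≥0∞) * 6000 * U := by rw [mul_assoc]
      _ ≤ 1 * U := by gcongr
      _ = U := one_mul U
  · calc ((1 / 150000 : ℝ≥0) : ℝ≥0∞) * L ^ (5 / 4 : ℝ)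
        ≤ ((1 / 150000 : ℝ≥0) : ℝ≥0∞) * (5 * (m : ℝ≥0∞) ^ 4) ^ (5 / 4 : ℝ) := by
          push_cast at hL'
          gcongr
      _ = ((1 / 150000 : ℝ≥0) : ℝ≥0∞) * (5 ^ (5 / 4 : ℝ) * (m : ℝ≥0∞) ^ 5) := by
          rw [ENNReal.mul_rpow_of_nonneg _ _ (by norm_num), ENNReal.pow_four_rpow]
      _ ≤ ((1 / 150000 : ℝ≥0) : ℝ≥0∞) * (25 * (6000 * U)) := by gcongr
      _ = ((1 / 150000 : ℝ≥0) : ℝ≥0∞) * 25 * 6000 * U := by ring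
      _ ≤ 1 * U := by gcongr
      _ = U := one_mul U
  -- From `m ≥ 3000` follows `m ^ 2 ≥ 4800000`, hence `L ≥ 2400000 * m` with `2400000 = 16 *
  -- 150000`; moreover `L ≤ L ^ (5 / 4)`.
  · have hbig : (4800000 * m : ℝ≥0∞) ≤ (m : ℝ≥0∞) ^ 3 := by
      have : 4800000 * m ≤ m ^ 3 := by
        have : m ^ 3 = m * m * m := by ring
        rw [this]
        exact Nat.mul_le_mul_right m (by nlinarith)
      exact_mod_cast this
    have h1 : (2400000 * m : ℝ≥0∞) ≤ L := by
      have h2 : (2 : ℝ≥0∞) * (2400000 * m) ≤ 2 * L := by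
        refine le_trans (le_of_eq ?_) (hbig.trans hL)
        rw [← mul_assoc]; norm_num
      exact (ENNReal.mul_le_mul_iff_right (by norm_num) (by norm_num)).1 h2
    have h3 : (1 : ℝ≥0∞) ≤ L := by
      refine le_trans ?_ h1
      have : 1 ≤ 2400000 * m := by omega
      exact_mod_cast this
    have h4 : L ≤ L ^ (5 / 4 : ℝ) := by
      conv_lhs => rw [← ENNReal.rpow_one L]
      exact ENNReal.rpow_le_rpow_of_exponent_le h3 (by norm_num)
    calc 16 * (m : ℝ≥0∞) = ((1 / 150000 : ℝ≥0) : ℝ≥0∞) * (2400000 * m) := by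
          have : (1 / 150000 : ℝ≥0) * 2400000 = 16 := by
            rw [← NNReal.coe_inj]; push_cast; norm_num
          have h6 : ((1 / 150000 : ℝ≥0) : ℝ≥0∞) * 2400000 = 16 := by
            exact_mod_cast congrArg ((↑) : ℝ≥0 → ℝ≥0∞) this
          rw [← mul_assoc, h6]
      _ ≤ _ := by gcongr; exact h1.trans h4

/-- The factor 2 in the hypothesis leaves room for input lengths between consecutive members of the
family. -/
lemma natCast_rpow_le {m N : ℕ} (hN : N ≤ 8 * (2 * m) ^ 22) :
    (N : ℝ≥0∞) ^ (1 / 22 : ℝ) ≤ 16 * m := by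
  have h1 : N ≤ (16 * m) ^ 22 := by
    refine hN.trans ?_
    have : (16 * m) ^ 22 = 8 ^ 22 * (2 * m) ^ 22 := by rw [← mul_pow]; ring
    rw [this]
    gcongr
    norm_num
  have h2 : (N : ℝ≥0∞) ≤ (16 * m : ℝ≥0∞) ^ (22 : ℝ) := by
    have : (22 : ℝ) = ((22 : ℕ) : ℝ) := by norm_num
    rw [this, ENNReal.rpow_natCast]
    exact_mod_cast h1
  calc (N : ℝ≥0∞) ^ (1 / 22 : ℝ) ≤ ((16 * m : ℝ≥0∞) ^ (22 : ℝ)) ^ (1 / 22 : ℝ) := by gcongr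
    _ = 16 * m := by rw [← ENNReal.rpow_mul]; norm_num

/-- Both `LR` and `ULR` are separated for the explicit family (whose `m`-th member has
`8 m ^ 18 * m ^ 4` input bits), and for some function on every large number `N` of bits. -/
theorem theorem1p6 :
    ∃ (c C : ℝ≥0) (δ : ℝ), 0 < c ∧ 0 < C ∧ 0 < δ ∧
      (∀ᶠ m : ℕ in Filter.atTop,
        LR (sepFamily m) ≤ C * ((m ^ 4 : ℕ) : ℝ≥0∞) ∧
        c * ((m ^ 4 : ℕ) : ℝ≥0∞) ^ (5 / 4 : ℝ) ≤ ULR (sepFamily m) ∧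
        c * LR (sepFamily m) ^ (5 / 4 : ℝ) ≤ ULR (sepFamily m) ∧
        ((8 * m ^ 18 * m ^ 4 : ℕ) : ℝ≥0∞) ^ δ ≤ c * LR (sepFamily m) ^ (5 / 4 : ℝ)) ∧
      (∀ᶠ N : ℕ in Filter.atTop,
        ∃ f : PartialBoolFun (Fin N),
          c * LR f ^ (5 / 4 : ℝ) ≤ ULR f ∧
          (N : ℝ≥0∞) ^ δ ≤ c * LR f ^ (5 / 4 : ℝ)) := by
  refine ⟨1 / 150000, 5, 1 / 22, by norm_num, by norm_num, by norm_num, ?_, ?_⟩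
  · filter_upwards [Filter.eventually_ge_atTop 3000] with m hm
    obtain ⟨h1, h2, h3, h4⟩ := sepFamily_separation hm (Function.Embedding.refl _)
    refine ⟨h1, h2, h3, (natCast_rpow_le ?_).trans h4⟩
    have : 8 * m ^ 18 * m ^ 4 = 8 * m ^ 22 := by ring
    rw [this]
    gcongr
    omega
  · filter_upwards [Filter.eventually_ge_atTop (8 * 3000 ^ 22)] with N hN
    have hle : 3000 ≤ N := le_trans (by norm_num) hN
    -- The largest member of the family that fits into `N` bits is used and the other bits are
    -- ignored. Maximality of `m` excludes `2 * m`, which bounds `N` from above.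
    set m := Nat.findGreatest (fun m => 8 * m ^ 22 ≤ N) N with hmdef
    have hm : 3000 ≤ m := Nat.le_findGreatest hle hN
    have hmN : 8 * m ^ 22 ≤ N := Nat.findGreatest_spec (P := fun m => 8 * m ^ 22 ≤ N) hle hN
    have hNm : N ≤ 8 * (2 * m) ^ 22 := by
      by_contra hlt
      have h1 : 8 * (2 * m) ^ 22 ≤ N := (not_le.1 hlt).le
      have h2 : 2 * m ≤ N := by
        refine le_trans ?_ h1
        have := Nat.le_self_pow (n := 22) (by norm_num) (2 * m)
        omega
      have h3 : 2 * m ≤ m := Nat.le_findGreatest h2 h1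
      omega
    have hcard : Fintype.card (Fin (8 * m ^ 18) × Fin (m ^ 4)) ≤ Fintype.card (Fin N) := by
      have : 8 * m ^ 18 * m ^ 4 = 8 * m ^ 22 := by ring
      simp only [Fintype.card_prod, Fintype.card_fin]
      omega
    obtain ⟨e⟩ := Function.Embedding.nonempty_of_card_le hcard
    obtain ⟨-, -, h3, h4⟩ := sepFamily_separation hm e
    exact ⟨_, h3, (natCast_rpow_le hNm).trans h4⟩
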